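/- Let $U,V,H$ be real separable Hilbert spaces with $V\hookrightarrow H\hookrightarrow V'$ a Gelfand triple ($V$ continuously and densely embedded in $H$). Let $T>0$, $\theta>0$, and let $\mathfrak S=[-1,1]^{\mathbb N}$ carry the product topology and the countable product of the uniform distributions on $[-1,1]$, with expectation $\mathbb E$. For random variables $X\in L^\infty(\mathfrak S;\mathbb R)$ let $\mathcal R_\theta(X)=\frac1\theta\log\mathbb E[e^{\theta X}]$ be the entropic risk measure. Let $A:\mathfrak S\to\mathcal L(V,V')$ be continuous and uniformly bounded, and suppose that there are $\rho\in\mathbb R$ and $\alpha>0$ with $$-\langle A(\sigma)v,v\rangle_{V',V}+\rho\|v\|_H^2\ge\alpha\|v\|_V^2\qquad\text{for all } v\in V,\ \sigma\in\mathfrak S .$$ Let $B\in\mathcal L(U,H)$, $C,P\in\mathcal L(H)$, $f\in L^2(0,T;V')$, $y_0,g_T\in H$ and $g\in C([0,T];H)$. For $u\in L^2(0,T;U)$ and $\sigma\in\mathfrak S$, a state is a function $y\in L^2(0,T;V)$ with weak derivative $\dot y\in L^2(0,T;V')$, identified with its representative in $C([0,T];H)$, such that $$\dot y=A(\sigma)y+Bu+f\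 \text{ in } L^2(0,T;V'),\qquad y(0)=y_0 .$$ For $u\in L^2(0,T;U)$ and a family $y=(y(\sigma;\cdot))_{\sigma\in\mathfrak S}$ of states for $u$, put $$\mathcal J(u,y)=\frac12\Big(\int_0^T\big(\mathcal R_\theta(\|C(y(\cdot;t)-g(t))\|_H^2)+\|u(t)\|_U^2\big)\,dt+\mathcal R_\theta(\|P(y(\cdot;T)-g_T)\|_H^2)\Big).$$ Then: 1. For all $u$ and $\sigma$ there is exactly one state $y_u(\sigma;\cdot)\in C([0,T];H)$, and $\sigma\mapsto y_u(\sigma;\cdot)\in C([0,T];H)$ is continuous. All integrals in $J(u):=\mathcal J(u,y_u)$ exist. 2. $J:L^2(0,T;U)\to\mathbb R$ is continuous and coercive, with $J(u)\ge\frac12\|u\|^2_{L^2(0,T;U)}$, and strongly convex with modulus $1$, that is, for all $u,w$ and $\lambda\in[0,1]$, $$J(\lambda u+(1-\lambda)w)\le\lambda J(u)+(1-\lambda)J(w)-\tfrac12\lambda(1-\lambda)\|u-w\|^2_{L^2(0,T;U)} .$$ 3. $J$ has a unique minimizer in $L^2(0,T;U)$. 4. Equivalently, the problem of minimizing $\mathcal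 J(u,y)$ over all pairs $(u,y)$ such that $y(\sigma;\cdot)$ is a state for $u$ for every $\sigma\in\mathfrak S$ has a unique solution. -/

import Mathlib

open MeasureTheory Set
open scoped ENNReal ContDiff

namespace RiskAverse

noncomputable section

/-- The parameter domain `[-1,1]^ℕ`, with the product topology and the product σ-algebra. -/
abbrev Param : Type := ℕ → Set.Icc (-1 : ℝ) 1

/-- The uniform distribution `dσ / 2` on `[-1,1]`. -/
def uniformMeasure : Measure (Set.Icc (-1 : ℝ) 1) :=
  (2 : ℝ≥0∞)⁻¹ • (volume : Measure ℝ).comap Subtype.val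

instance uniformMeasure_isProbabilityMeasure : IsProbabilityMeasure uniformMeasure := by
  constructor
  have h : ((volume : Measure ℝ).comap Subtype.val :
      Measure (Set.Icc (-1 : ℝ) 1)) Set.univ = 2 := by
    rw [comap_subtype_coe_apply measurableSet_Icc, Set.image_univ, Subtype.range_coe,
      Real.volume_Icc]
    norm_num
  rw [uniformMeasure, Measure.smul_apply, h, smul_eq_mul]
  exact ENNReal.inv_mul_cancel (by norm_num) (by norm_num)

/-- The law of the parameter sequence: the countable product of the uniform distributions. -/
def paramMeasure : Measure Param := Measure.infinitePi (fun _ : ℕ => uniformMeasure)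

/-- The entropic risk measure `(1/θ) log 𝔼[exp(θ X)]`. -/
def entropicRisk (θ : ℝ) (X : Param → ℝ) : ℝ :=
  1 / θ * Real.log (∫ σ, Real.exp (θ * X σ) ∂paramMeasure)

/-- Lebesgue measure on the time interval `(0,T)`. -/
abbrev timeMeasure (T : ℝ) : Measure ℝ := volume.restrict (Set.Ioo 0 T)

/-- The Bochner space `L²(0,T;X)`. -/
abbrev L2 (T : ℝ) (X : Type*) [NormedAddCommGroup X] : Type _ := Lp X 2 (timeMeasure T)

/-- `z` is the weak (distributional) derivative of `w` on `(0,T)`. -/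
def HasWeakTimeDeriv {E : Type*} [NormedAddCommGroup E] [NormedSpace ℝ E]
    (T : ℝ) (w z : ℝ → E) : Prop :=
  ∀ φ : ℝ → ℝ, ContDiff ℝ ∞ φ → HasCompactSupport φ → tsupport φ ⊆ Set.Ioo 0 T →
    ∫ t in Set.Ioo 0 T, deriv φ t • w t = -∫ t in Set.Ioo 0 T, φ t • z t

variable (U V H : Type*)
  [NormedAddCommGroup U] [InnerProductSpace ℝ U]
  [NormedAddCommGroup V] [InnerProductSpace ℝ V]
  [NormedAddCommGroup H] [InnerProductSpace ℝ H]

/-- The data of the optimal control problem. -/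
structure Problem where
  /-- the time horizon -/
  T : ℝ
  T_pos : 0 < T
  /-- the risk-aversion parameter -/
  θ : ℝ
  θ_pos : 0 < θ
  /-- the embedding of `V` into the pivot space `H` -/
  ι : V →L[ℝ] H
  ι_injective : Function.Injective ι
  ι_denseRange : DenseRange ι
  /-- the operators `A(σ) ∈ L(V, V')` -/
  A : Param → V →L[ℝ] StrongDual ℝ V
  A_continuous : Continuous A
  /-- with `a(σ;v,w) = -⟨A(σ)v, w⟩`:  `a(σ;v,v) + ρ ‖v‖_H² ≥ α ‖v‖_V²`, uniformly in `σ` -/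
  A_coercive : ∃ ρ α : ℝ, 0 < α ∧ ∀ (σ : Param) (v : V),
    α * ‖v‖ ^ 2 ≤ -(A σ v v) + ρ * ‖ι v‖ ^ 2
  A_bounded : ∃ c : ℝ, ∀ σ : Param, ‖A σ‖ ≤ c
  B : U →L[ℝ] H
  /-- the observation operators and the targets -/
  C : H →L[ℝ] H
  P : H →L[ℝ] H
  g : C(Set.Icc (0 : ℝ) T, H)
  gT : H
  f : L2 T (StrongDual ℝ V)
  y₀ : H

namespace Problem

variable {U V H}
variable (Q : Problem U V H)

/-- The embedding `H → V'`, `h ↦ ⟨h, ι ·⟩_H`, of the Gelfand triple. -/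
def toDual (h : H) : StrongDual ℝ V := (innerSL ℝ h).comp Q.ι

/-- A trajectory `[0,T] → H`, extended by constants so that it can be evaluated at every real. -/
def eval (y : C(Set.Icc (0 : ℝ) Q.T, H)) (t : ℝ) : H := Set.IccExtend Q.T_pos.le y t

/-- `y` is the solution in `W(0,T;V,V')`, through its representative in `C([0,T];H)`, of
`ẏ = A(σ) y + B u + f` in `L²(0,T;V')`, `y(0) = y₀`: here `v` is `y` as an element of `L²(0,T;V)`
and `dv ∈ L²(0,T;V')` is its weak time derivative. -/
def IsState (σ : Param) (u : L2 Q.T U) (y : C(Set.Icc (0 : ℝ) Q.T, H)) : Prop :=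
  ∃ (v : L2 Q.T V) (dv : L2 Q.T (StrongDual ℝ V)),
    HasWeakTimeDeriv Q.T (fun t => Q.toDual (Q.ι (v t))) (fun t => dv t) ∧
    (∀ᵐ t ∂timeMeasure Q.T, Q.ι (v t) = Q.eval y t) ∧
    (∀ᵐ t ∂timeMeasure Q.T, dv t = Q.A σ (v t) + Q.toDual (Q.B (u t)) + Q.f t) ∧
    Q.eval y 0 = Q.y₀

/-- The state `y_u(σ)` belonging to the control `u`: the function satisfying `IsState`. -/
def state (u : L2 Q.T U) (σ : Param) : C(Set.Icc (0 : ℝ) Q.T, H) :=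
  Classical.epsilon (fun y => Q.IsState σ u y)

/-- The integrand of the running cost. -/
def runningCost (u : L2 Q.T U) (y : Param → C(Set.Icc (0 : ℝ) Q.T, H)) (t : ℝ) : ℝ :=
  entropicRisk Q.θ (fun σ => ‖Q.C (Q.eval (y σ) t - Q.eval Q.g t)‖ ^ 2) + ‖u t‖ ^ 2

/-- The cost functional of a control and a parametric family of trajectories. -/
def cost (u : L2 Q.T U) (y : Param → C(Set.Icc (0 : ℝ) Q.T, H)) : ℝ :=
  1 / 2 * ((∫ t in Set.Ioo 0 Q.T, Q.runningCost u y t) +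
    entropicRisk Q.θ (fun σ => ‖Q.P (Q.eval (y σ) Q.T - Q.gT)‖ ^ 2))

/-- The reduced cost functional `J(u)`. -/
def reducedCost (u : L2 Q.T U) : ℝ := Q.cost u (Q.state u)

/-- Feasible pairs of the original problem: `y(σ)` is the state of `u` for every `σ`. -/
def Feasible (p : L2 Q.T U × (Param → C(Set.Icc (0 : ℝ) Q.T, H))) : Prop :=
  ∀ σ : Param, Q.IsState σ p.1 (p.2 σ)

end Problem

end

end RiskAverse

/-!
After identifying `V'` with `V` by the Riesz isomorphism, the state equation is an integral
equation for a pair `(v, y)` in `L²(0,T;V) × C([0,T];H)`, and its solutions form a closed linear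
relation between data and solutions. Gårding's inequality and Gronwall's lemma bound a regular
curve by its data. A functional annihilating the data of all regular curves solves, after time
reversal, the adjoint equation with zero data, hence vanishes; so these data are dense, and the
solution operator extends to all data with the same bound. Comparing two values of `σ` amounts to
perturbing the data by `(A(σ) - A(σ'))v`, which gives continuity in `σ`.

The state is affine in the control and the entropic risk measure is monotone and convex, so
`J(u) - ½‖u‖²` is convex, continuous and nonnegative. Minimizing sequences of the strongly convex
function `J` are Cauchy.
-/

namespace RiskAverse

open scoped RealInnerProductSpace Topology BoundedContinuousFunction InnerProduct

section TimeIntegration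

variable {E F G : Type*} [NormedAddCommGroup E] [NormedSpace ℝ E]
  [NormedAddCommGroup F] [NormedSpace ℝ F] [NormedAddCommGroup G] [NormedSpace ℝ G] {T : ℝ}

theorem setIntegral_Ioo_eq_intervalIntegral (hT : 0 ≤ T) (w : ℝ → E) :
    ∫ t in Ioo 0 T, w t = ∫ t in (0 : ℝ)..T, w t := by
  rw [intervalIntegral.integral_of_le hT, integral_Ioc_eq_integral_Ioo]

theorem intervalIntegral_timeMeasure {r t : ℝ} (hr : 0 ≤ r) (hrt : r ≤ t) (ht : t ≤ T)
    (w : ℝ → E) : ∫ s in r..t, w s ∂timeMeasure T = ∫ s in r..t, w s := by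
  rw [intervalIntegral.integral_of_le hrt, intervalIntegral.integral_of_le hrt,
    integral_Ioc_eq_integral_Ioo, integral_Ioc_eq_integral_Ioo, timeMeasure,
    Measure.restrict_restrict measurableSet_Ioo, Ioo_inter_Ioo, max_eq_left hr, min_eq_left ht]

theorem exists_integral_norm_le (T : ℝ) (E : Type*) [NormedAddCommGroup E] :
    ∃ K : ℝ, ∀ x : L2 T E, ∫ t, ‖x t‖ ∂timeMeasure T ≤ K * ‖x‖ := by
  refine ⟨((timeMeasure T univ) ^ (1 / (1 : ℝ) - 1 / (2 : ℝ))).toReal, fun x => ?_⟩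
  have h := eLpNorm_le_eLpNorm_mul_rpow_measure_univ (p := 1) (q := 2) (μ := timeMeasure T)
    one_le_two (Lp.aestronglyMeasurable x)
  rw [integral_norm_eq_lintegral_enorm (Lp.aestronglyMeasurable x),
    ← eLpNorm_one_eq_lintegral_enorm, Lp.norm_def, mul_comm, ← ENNReal.toReal_mul]
  refine ENNReal.toReal_mono (ENNReal.mul_ne_top (Lp.eLpNorm_ne_top x) ?_) (by simpa using h)
  exact ENNReal.rpow_ne_top_of_nonneg (by norm_num) (measure_ne_top _ _)

theorem integrable_coeFn {E : Type*} [NormedAddCommGroup E] (x : L2 T E) :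
    Integrable x (timeMeasure T) :=
  (Lp.memLp x).integrable one_le_two

/-- The primitive `t ↦ ∫₀ᵗ x` of an `L²` function, as a continuous function on `[0,T]`. -/
noncomputable def primitive (T : ℝ) (E : Type*) [NormedAddCommGroup E] [NormedSpace ℝ E] :
    L2 T E →L[ℝ] C(Icc (0 : ℝ) T, E) :=
  LinearMap.mkContinuousOfExistsBound
    { toFun := fun x => ⟨fun t => ∫ s in (0 : ℝ)..t, x s ∂timeMeasure T,
        (intervalIntegral.continuous_primitive
          (fun _ _ => (integrable_coeFn x).intervalIntegrable) 0).comp continuous_subtype_val⟩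
      map_add' := fun x y => ContinuousMap.ext fun t =>
        (intervalIntegral.integral_congr_ae_restrict
          (ae_restrict_of_ae (Lp.coeFn_add x y))).trans
          (intervalIntegral.integral_add (integrable_coeFn x).intervalIntegrable
            (integrable_coeFn y).intervalIntegrable)
      map_smul' := fun c x => ContinuousMap.ext fun t =>
        (intervalIntegral.integral_congr_ae_restrict
          (ae_restrict_of_ae (Lp.coeFn_smul c x))).trans
          (intervalIntegral.integral_smul c x) }
    (by
      obtain ⟨K, hK⟩ := exists_integral_norm_le T E
      refine ⟨K, fun x => ?_⟩
      refine (ContinuousMap.norm_le _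
        ((integral_nonneg fun _ => norm_nonneg _).trans (hK x))).2 fun t => ?_
      calc ‖∫ s in (0 : ℝ)..t, x s ∂timeMeasure T‖
          ≤ ∫ s in uIoc 0 (t : ℝ), ‖x s‖ ∂timeMeasure T :=
            intervalIntegral.norm_integral_le_integral_norm_uIoc
        _ ≤ ∫ s, ‖x s‖ ∂timeMeasure T :=
            setIntegral_le_integral (integrable_coeFn x).norm
              (Filter.Eventually.of_forall fun _ => norm_nonneg _)
        _ ≤ K * ‖x‖ := hK x)

theorem primitive_apply (x : L2 T E) (t : Icc (0 : ℝ) T) :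
    primitive T E x t = ∫ s in (0 : ℝ)..t, x s ∂timeMeasure T := rfl

/-- The extension of a continuous function on `[0,T]` to `ℝ` by constants, as in `IccExtend`. -/
noncomputable def extendConst (hT : 0 ≤ T) (E : Type*) [NormedAddCommGroup E] [NormedSpace ℝ E] :
    C(Icc (0 : ℝ) T, E) →L[ℝ] (ℝ →ᵇ E) :=
  LinearMap.mkContinuous
    { toFun := fun y => (BoundedContinuousFunction.mkOfCompact y).compContinuous
        ⟨projIcc 0 T hT, continuous_projIcc⟩
      map_add' := fun _ _ => rfl
      map_smul' := fun _ _ => rfl } 1 fun y => by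
    rw [one_mul]
    exact (BoundedContinuousFunction.norm_le (norm_nonneg _)).2 fun t => y.norm_coe_le_norm _

/-- The inclusion of `C([0,T];E)` into `L²(0,T;E)`. -/
noncomputable def toL2 (hT : 0 ≤ T) (E : Type*) [NormedAddCommGroup E] [NormedSpace ℝ E] :
    C(Icc (0 : ℝ) T, E) →L[ℝ] L2 T E :=
  (BoundedContinuousFunction.toLp 2 (timeMeasure T) ℝ).comp (extendConst hT E)

theorem coeFn_toL2 (hT : 0 ≤ T) (y : C(Icc (0 : ℝ) T, E)) :
    toL2 hT E y =ᵐ[timeMeasure T] IccExtend hT y :=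
  BoundedContinuousFunction.coeFn_toLp (𝕜 := ℝ) 2 (timeMeasure T) _

theorem coeFn_toL2_restrict (hT : 0 ≤ T) (y : C(ℝ, E)) :
    toL2 hT E (y.restrict (Icc 0 T)) =ᵐ[timeMeasure T] y := by
  filter_upwards [coeFn_toL2 hT (y.restrict (Icc 0 T)), ae_restrict_mem measurableSet_Ioo]
    with t h ht
  rw [h, IccExtend_of_mem _ _ (Ioo_subset_Icc_self ht), ContinuousMap.restrict_apply]

theorem denseRange_toL2 (hT : 0 ≤ T) : DenseRange (toL2 hT E) := by
  refine Dense.mono ?_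
    (BoundedContinuousFunction.toLp_denseRange E (timeMeasure T) ℝ (p := 2) (by norm_num))
  rintro _ ⟨z, rfl⟩
  exact ⟨z.toContinuousMap.restrict (Icc 0 T), Lp.ext ((coeFn_toL2_restrict hT _).trans
    (BoundedContinuousFunction.coeFn_toLp (𝕜 := ℝ) 2 (timeMeasure T) z).symm)⟩

theorem primitive_toL2 (hT : 0 ≤ T) (x : C(Icc (0 : ℝ) T, E)) (t : Icc (0 : ℝ) T) :
    primitive T E (toL2 hT E x) t = ∫ s in (0 : ℝ)..t, IccExtend hT x s := by
  rw [primitive_apply, ← intervalIntegral_timeMeasure le_rfl t.2.1 t.2.2]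
  exact intervalIntegral.integral_congr_ae_restrict (ae_restrict_of_ae (coeFn_toL2 hT x))

theorem coeFn_toL2_primitive_toL2 (hT : 0 ≤ T) (x : C(Icc (0 : ℝ) T, E)) :
    toL2 hT E (primitive T E (toL2 hT E x)) =ᵐ[timeMeasure T]
      fun t => ∫ s in (0 : ℝ)..t, IccExtend hT x s := by
  filter_upwards [coeFn_toL2 hT (primitive T E (toL2 hT E x)),
    ae_restrict_mem measurableSet_Ioo] with t h ht
  rw [h, IccExtend_of_mem _ _ (Ioo_subset_Icc_self ht), primitive_toL2]

theorem hasDerivAt_integral_IccExtend [CompleteSpace E] (hT : 0 ≤ T) (x : C(Icc (0 : ℝ) T, E))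
    (t : ℝ) : HasDerivAt (fun r => ∫ s in (0 : ℝ)..r, IccExtend hT x s) (IccExtend hT x t) t :=
  x.continuous.Icc_extend'.integral_hasStrictDerivAt 0 t |>.hasDerivAt

/-- The operator on `L²(0,T;·)` which applies a fixed operator at almost every time. -/
noncomputable abbrev pointwise (T : ℝ) (M : E →L[ℝ] F) : L2 T E →L[ℝ] L2 T F :=
  M.compLpL 2 (timeMeasure T)

theorem primitive_pointwise [CompleteSpace E] [CompleteSpace F] (M : E →L[ℝ] F) (x : L2 T E)
    (t : Icc (0 : ℝ) T) : primitive T F (pointwise T M x) t = M (primitive T E x t) := by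
  rw [primitive_apply, primitive_apply, ← ContinuousLinearMap.intervalIntegral_comp_comm M
    (integrable_coeFn x).intervalIntegrable]
  exact intervalIntegral.integral_congr_ae_restrict (ae_restrict_of_ae (M.coeFn_compLpL x))

theorem pointwise_toL2 (hT : 0 ≤ T) (M : E →L[ℝ] F) (y : C(Icc (0 : ℝ) T, E)) :
    pointwise T M (toL2 hT E y) = toL2 hT F ((M : C(E, F)).comp y) := by
  refine Lp.ext ?_
  filter_upwards [M.coeFn_compLpL (toL2 hT E y), coeFn_toL2 hT y,
    coeFn_toL2 hT ((M : C(E, F)).comp y)] with t h1 h2 h3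
  rw [h1, h2, h3]
  rfl

variable [CompleteSpace E] [CompleteSpace F] [CompleteSpace G]

theorem integral_bilin_primitive_toL2 (hT : 0 ≤ T) (B : E →L[ℝ] F →L[ℝ] G)
    (x : C(Icc (0 : ℝ) T, E)) (y : C(Icc (0 : ℝ) T, F)) :
    ∫ t, B (toL2 hT E (primitive T E (toL2 hT E x)) t) (toL2 hT F y t) ∂timeMeasure T +
      ∫ t, B (toL2 hT E x t) (toL2 hT F (primitive T F (toL2 hT F y)) t) ∂timeMeasure T =
    B (primitive T E (toL2 hT E x) ⟨T, right_mem_Icc.2 hT⟩)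
      (primitive T F (toL2 hT F y) ⟨T, right_mem_Icc.2 hT⟩) := by
  set X : ℝ → E := fun t => ∫ s in (0 : ℝ)..t, IccExtend hT x s
  set Y : ℝ → F := fun t => ∫ s in (0 : ℝ)..t, IccExtend hT y s
  have hX : ∀ t, HasDerivAt X (IccExtend hT x t) t := hasDerivAt_integral_IccExtend hT x
  have hY : ∀ t, HasDerivAt Y (IccExtend hT y t) t := hasDerivAt_integral_IccExtend hT y
  have _ : Continuous (IccExtend hT x) := x.continuous.Icc_extend'
  have _ : Continuous (IccExtend hT y) := y.continuous.Icc_extend'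
  have hXc : Continuous X := continuous_iff_continuousAt.2 fun t => (hX t).continuousAt
  have hYc : Continuous Y := continuous_iff_continuousAt.2 fun t => (hY t).continuousAt
  have hXy : ∫ t, B (toL2 hT E (primitive T E (toL2 hT E x)) t) (toL2 hT F y t) ∂timeMeasure T =
      ∫ t in (0 : ℝ)..T, B (X t) (IccExtend hT y t) := by
    rw [← setIntegral_Ioo_eq_intervalIntegral hT]
    refine integral_congr_ae ?_
    filter_upwards [coeFn_toL2_primitive_toL2 hT x, coeFn_toL2 hT y] with t h1 h2
    rw [h1, h2]
  have hxY : ∫ t, B (toL2 hT E x t) (toL2 hT F (primitive T F (toL2 hT F y)) t) ∂timeMeasure T =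
      ∫ t in (0 : ℝ)..T, B (IccExtend hT x t) (Y t) := by
    rw [← setIntegral_Ioo_eq_intervalIntegral hT]
    refine integral_congr_ae ?_
    filter_upwards [coeFn_toL2 hT x, coeFn_toL2_primitive_toL2 hT y] with t h1 h2
    rw [h1, h2]
  rw [hXy, hxY, ← intervalIntegral.integral_add
      (Continuous.intervalIntegrable (by fun_prop) _ _)
      (Continuous.intervalIntegrable (by fun_prop) _ _),
    intervalIntegral.integral_eq_sub_of_hasDerivAt (f := fun t => B (X t) (Y t))
      (fun t _ => B.hasDerivAt_of_bilinear (fun _ => hX t) fun _ => hY t)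
      (Continuous.intervalIntegrable (by fun_prop) _ _)]
  simp only [X, Y, primitive_toL2, intervalIntegral.integral_same, map_zero, sub_zero]

theorem integral_bilin_primitive (hT : 0 ≤ T) (B : E →L[ℝ] F →L[ℝ] G) (x : L2 T E) (y : L2 T F) :
    ∫ t, B (toL2 hT E (primitive T E x) t) (y t) ∂timeMeasure T +
      ∫ t, B (x t) (toL2 hT F (primitive T F y) t) ∂timeMeasure T =
    B (primitive T E x ⟨T, right_mem_Icc.2 hT⟩) (primitive T F y ⟨T, right_mem_Icc.2 hT⟩) := by
  have hB (x' : L2 T E) (y' : L2 T F) : ∫ t, B (x' t) (y' t) ∂timeMeasure T =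
      B.lpPairing (timeMeasure T) 2 2 x' y' := (B.lpPairing_eq_integral x' y').symm
  simp only [hB]
  refine ((denseRange_toL2 hT).prodMap (denseRange_toL2 hT)).induction_on
    (p := fun z => B.lpPairing (timeMeasure T) 2 2 (toL2 hT E (primitive T E z.1)) z.2 +
      B.lpPairing (timeMeasure T) 2 2 z.1 (toL2 hT F (primitive T F z.2)) =
      B (primitive T E z.1 ⟨T, right_mem_Icc.2 hT⟩) (primitive T F z.2 ⟨T, right_mem_Icc.2 hT⟩))
    (x, y) (isClosed_eq (by fun_prop) (by fun_prop)) fun z => ?_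
  simpa only [hB, Prod.map_fst, Prod.map_snd] using integral_bilin_primitive_toL2 hT B z.1 z.2

end TimeIntegration

section WeakDerivative

variable {E : Type*} [NormedAddCommGroup E] [NormedSpace ℝ E] {T : ℝ}

theorem HasWeakTimeDeriv.congr {w z w' z' : ℝ → E} (h : HasWeakTimeDeriv T w z)
    (hw : w =ᵐ[timeMeasure T] w') (hz : z =ᵐ[timeMeasure T] z') : HasWeakTimeDeriv T w' z' := by
  intro φ hφ hc hs
  rw [← integral_congr_ae (hw.mono fun t ht => congrArg (deriv φ t • ·) ht),
    ← integral_congr_ae (hz.mono fun t ht => congrArg (φ t • ·) ht), h φ hφ hc hs]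

theorem HasWeakTimeDeriv.sub {w z w' z' : ℝ → E} (h : HasWeakTimeDeriv T w z)
    (h' : HasWeakTimeDeriv T w' z') (hw : Integrable w (timeMeasure T))
    (hz : Integrable z (timeMeasure T)) (hw' : Integrable w' (timeMeasure T))
    (hz' : Integrable z' (timeMeasure T)) :
    HasWeakTimeDeriv T (fun t => w t - w' t) (fun t => z t - z' t) := by
  intro φ hφ hc hs
  have hφ' : Continuous (deriv φ) := hφ.continuous_deriv (by simp)
  simp only [smul_sub]
  rw [integral_sub (hw.locallyIntegrable.integrable_smul_left_of_hasCompactSupport hφ' hc.deriv)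
      (hw'.locallyIntegrable.integrable_smul_left_of_hasCompactSupport hφ' hc.deriv),
    integral_sub (hz.locallyIntegrable.integrable_smul_left_of_hasCompactSupport hφ.continuous hc)
      (hz'.locallyIntegrable.integrable_smul_left_of_hasCompactSupport hφ.continuous hc),
    h φ hφ hc hs, h' φ hφ hc hs, neg_sub_neg, neg_sub]

variable [CompleteSpace E]

theorem primitive_toL2_deriv (hT : 0 ≤ T) {w : ℝ → E} (hw : Differentiable ℝ w)
    (hw' : Continuous (deriv w)) (t : Icc (0 : ℝ) T) :
    primitive T E (toL2 hT E (ContinuousMap.restrict (Icc 0 T) ⟨deriv w, hw'⟩)) t =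
      w t - w 0 := by
  rw [primitive_apply, ← intervalIntegral.integral_deriv_eq_sub (fun s _ => hw s)
    (hw'.intervalIntegrable _ _), ← intervalIntegral_timeMeasure le_rfl t.2.1 t.2.2]
  exact intervalIntegral.integral_congr_ae_restrict
    (ae_restrict_of_ae (coeFn_toL2_restrict hT _))

theorem hasWeakTimeDeriv_of_eq_add_primitive (hT : 0 ≤ T) {y : C(Icc (0 : ℝ) T, E)} {z : L2 T E}
    {c : E} (h : ∀ t, y t = c + primitive T E z t) : HasWeakTimeDeriv T (IccExtend hT y) z := by
  intro φ hφ _ hs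
  have hφ0 : φ 0 = 0 := image_eq_zero_of_notMem_tsupport fun h => (hs h).1.false
  have hφT : φ T = 0 := image_eq_zero_of_notMem_tsupport fun h => (hs h).2.false
  have hφ' : Continuous (deriv φ) := hφ.continuous_deriv (by simp)
  set x := toL2 hT ℝ (ContinuousMap.restrict (Icc 0 T) ⟨deriv φ, hφ'⟩)
  have hx : primitive T ℝ x = ContinuousMap.restrict (Icc 0 T) ⟨φ, hφ.continuous⟩ :=
    ContinuousMap.ext fun t => by
      rw [primitive_toL2_deriv hT (hφ.differentiable (by simp)), hφ0, sub_zero]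
      rfl
  have hconst : ∫ t, deriv φ t • c ∂timeMeasure T = 0 := by
    rw [integral_smul_const, setIntegral_Ioo_eq_intervalIntegral hT,
      intervalIntegral.integral_deriv_eq_sub (fun t _ => hφ.differentiable (by simp) t)
        (hφ'.intervalIntegrable _ _), hφT, hφ0, sub_zero, zero_smul]
  have hparts := integral_bilin_primitive hT (ContinuousLinearMap.lsmul ℝ ℝ) x z
  simp only [hx, ContinuousLinearMap.lsmul_apply, ContinuousMap.restrict_apply,
    ContinuousMap.coe_mk, hφT, zero_smul] at hparts
  have hφz := integral_congr_ae ((coeFn_toL2_restrict hT ⟨φ, hφ.continuous⟩).mono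
    fun t ht => congrArg (· • z t) ht)
  have hφ'y : (fun t => deriv φ t • IccExtend hT y t) =ᵐ[timeMeasure T]
      fun t => deriv φ t • c + x t • toL2 hT E (primitive T E z) t := by
    filter_upwards [coeFn_toL2_restrict hT ⟨deriv φ, hφ'⟩, coeFn_toL2 hT (primitive T E z)]
      with t hxt hzt
    rw [hxt, hzt]
    exact (congrArg (deriv φ t • ·) (h _)).trans (smul_add _ _ _)
  rw [integral_congr_ae hφ'y, integral_add, hconst, zero_add]
  · exact eq_neg_of_add_eq_zero_right (by rwa [hφz] at hparts)
  · exact ((hφ'.continuousOn.integrableOn_compact isCompact_Icc).mono_set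
      Ioo_subset_Icc_self).smul_const c
  · exact memLp_one_iff_integrable.1 ((Lp.memLp _).smul (Lp.memLp x))

theorem exists_primitive_of_integral_eq_zero {ψ : ℝ → ℝ} (hψ : ContDiff ℝ ∞ ψ)
    (hc : HasCompactSupport ψ) {s : Set ℝ} (hs : s.OrdConnected) (hψs : tsupport ψ ⊆ s)
    (h0 : ∫ t, ψ t = 0) :
    ∃ φ : ℝ → ℝ, ContDiff ℝ ∞ φ ∧ HasCompactSupport φ ∧ tsupport φ ⊆ s ∧ deriv φ = ψ := by
  rcases (tsupport ψ).eq_empty_or_nonempty with hemp | hne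
  · rw [tsupport_eq_empty_iff] at hemp
    exact ⟨0, contDiff_zero_fun, .zero, by simp [tsupport], by simp [hemp]⟩
  obtain ⟨a, ha, ha'⟩ := hc.isCompact.exists_isLeast hne
  obtain ⟨b, hb, hb'⟩ := hc.isCompact.exists_isGreatest hne
  have hψi : Integrable ψ := hψ.continuous.integrable_of_hasCompactSupport hc
  have hzero {t : ℝ} (ht : t ∉ Icc a b) : ψ t = 0 :=
    image_eq_zero_of_notMem_tsupport fun h => ht ⟨ha' h, hb' h⟩
  set φ : ℝ → ℝ := fun t => ∫ r in Iic t, ψ r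
  have hφ' (t : ℝ) : HasDerivAt φ (ψ t) t := by
    have hsplit : φ = fun t => φ 0 + ∫ r in (0 : ℝ)..t, ψ r := funext fun t => by
      rw [← intervalIntegral.integral_Iic_sub_Iic hψi.integrableOn hψi.integrableOn,
        add_sub_cancel]
    rw [hsplit]
    exact (hψ.continuous.integral_hasStrictDerivAt 0 t).hasDerivAt.const_add (φ 0)
  have hderiv : deriv φ = ψ := funext fun t => (hφ' t).deriv
  have hsupp : Function.support φ ⊆ Icc a b := by
    refine fun t ht => ⟨?_, ?_⟩ <;> by_contra! hlt <;> refine ht ?_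
    · exact setIntegral_eq_zero_of_forall_eq_zero fun r hr =>
        hzero fun h => (h.1.trans hr).not_gt hlt
    · refine (setIntegral_eq_integral_of_forall_compl_eq_zero fun r hr => ?_).trans h0
      exact hzero fun h => (h.2.trans_lt hlt).not_ge (not_le.1 hr).le
  refine ⟨φ, ?_, .of_support_subset_isCompact isCompact_Icc hsupp,
    (closure_minimal hsupp isClosed_Icc).trans (hs.out (hψs ha) (hψs hb)), hderiv⟩
  rw [contDiff_infty_iff_deriv, hderiv]
  exact ⟨fun t => (hφ' t).differentiableAt, hψ⟩

theorem exists_testFunction_integral_eq_one {a b : ℝ} (hab : a < b) :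
    ∃ η : ℝ → ℝ, ContDiff ℝ ∞ η ∧ HasCompactSupport η ∧ tsupport η ⊆ Ioo a b ∧ ∫ t, η t = 1 := by
  let η : ContDiffBump ((a + b) / 2) :=
    ⟨(b - a) / 8, (b - a) / 4, by linarith, by linarith⟩
  refine ⟨η.normed volume, η.contDiff_normed, η.hasCompactSupport_normed, ?_, η.integral_normed⟩
  rw [η.tsupport_normed_eq, Real.closedBall_eq_Icc]
  exact Icc_subset_Ioo (by simp only [η]; linarith) (by simp only [η]; linarith)

/-- Subtracting a multiple of a fixed bump function turns an arbitrary test function into one of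
mean zero, that is, into the derivative of a test function. -/
theorem exists_ae_eq_const_of_hasWeakTimeDeriv_zero (hT : 0 < T) {w : ℝ → E}
    (hw : Integrable w (timeMeasure T)) (h : HasWeakTimeDeriv T w 0) :
    ∃ c : E, w =ᵐ[timeMeasure T] fun _ => c := by
  obtain ⟨η, hη, hηc, hηs, hη1⟩ := exists_testFunction_integral_eq_one hT
  set c : E := ∫ t in Ioo 0 T, η t • w t with hc
  have htest {ψ : ℝ → ℝ} (hψ : ContDiff ℝ ∞ ψ) (hψc : HasCompactSupport ψ)
      (hψs : tsupport ψ ⊆ Ioo 0 T) : ∫ t in Ioo 0 T, ψ t • w t = (∫ t, ψ t) • c := by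
    have hinteg {χ : ℝ → ℝ} (hχ : Continuous χ) (hχc : HasCompactSupport χ) :
        Integrable (fun t => χ t • w t) (timeMeasure T) :=
      hw.locallyIntegrable.integrable_smul_left_of_hasCompactSupport hχ hχc
    obtain ⟨φ, hφ, hφc, hφs, hφψ⟩ := exists_primitive_of_integral_eq_zero
      (ψ := fun t => ψ t - (∫ r, ψ r) * η t) (hψ.sub (contDiff_const.mul hη))
      (hψc.sub hηc.mul_left) ordConnected_Ioo
      ((tsupport_sub _ _).trans (union_subset hψs (tsupport_mul_subset_right.trans hηs)))
      (by rw [integral_sub (hψ.continuous.integrable_of_hasCompactSupport hψc)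
            ((hη.continuous.integrable_of_hasCompactSupport hηc).const_mul _),
          integral_const_mul, hη1, mul_one, sub_self])
    have hzero := h φ hφ hφc hφs
    simp only [hφψ, sub_smul, mul_smul, Pi.zero_apply, smul_zero, integral_zero, neg_zero]
      at hzero
    have hηint : Integrable (fun t => (∫ r, ψ r) • η t • w t) (timeMeasure T) :=
      (hinteg hη.continuous hηc).smul _
    rwa [integral_sub (hinteg hψ.continuous hψc) hηint, integral_smul, ← hc, sub_eq_zero] at hzero
  have hae := isOpen_Ioo.ae_eq_zero_of_integral_contDiff_smul_eq_zero (μ := volume)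
    (f := fun t => w t - c) (U := Ioo 0 T)
    (IntegrableOn.locallyIntegrableOn (hw.sub (integrable_const c))) fun ψ hψ hψc hψs => ?_
  · refine ⟨c, (ae_restrict_iff' measurableSet_Ioo).2 ?_⟩
    filter_upwards [hae] with t ht hmem using sub_eq_zero.1 (ht hmem)
  · have hoff : ∀ t ∉ Ioo 0 T, ψ t = 0 := fun t ht =>
      image_eq_zero_of_notMem_tsupport (mt (@hψs t) ht)
    have hψi := hψ.continuous.integrable_of_hasCompactSupport (μ := volume) hψc
    rw [← setIntegral_eq_integral_of_forall_compl_eq_zero fun t ht => by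
      rw [hoff t ht, zero_smul]]
    simp only [smul_sub]
    rw [integral_sub
        (hw.locallyIntegrable.integrable_smul_left_of_hasCompactSupport hψ.continuous hψc)
        (hψi.restrict.smul_const c), htest hψ hψc hψs, integral_smul_const,
      setIntegral_eq_integral_of_forall_compl_eq_zero hoff, sub_self]

theorem eq_add_primitive_of_hasWeakTimeDeriv (hT : 0 < T) {y : C(Icc (0 : ℝ) T, E)} {z : L2 T E}
    (h : HasWeakTimeDeriv T (IccExtend hT.le y) z) (t : Icc (0 : ℝ) T) :
    y t = y ⟨0, left_mem_Icc.2 hT.le⟩ + primitive T E z t := by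
  have hinteg (y : C(Icc (0 : ℝ) T, E)) : Integrable (IccExtend hT.le y) (timeMeasure T) :=
    (integrable_coeFn _).congr (coeFn_toL2 hT.le y)
  have hsub := h.sub (hasWeakTimeDeriv_of_eq_add_primitive hT.le (y := primitive T E z) (c := 0)
    fun t => (zero_add _).symm) (hinteg y) (integrable_coeFn z) (hinteg _) (integrable_coeFn z)
  obtain ⟨c, hc⟩ := exists_ae_eq_const_of_hasWeakTimeDeriv_zero hT ((hinteg y).sub (hinteg _))
    (hsub.congr .rfl (.of_eq (funext fun t => sub_self _)))
  have heq : EqOn (IccExtend hT.le y - IccExtend hT.le (primitive T E z)) (fun _ => c)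
      (Icc 0 T) :=
    Measure.eqOn_Icc_of_ae_eq volume hT.ne (by rwa [Measure.restrict_congr_set Ioo_ae_eq_Icc.symm])
      (y.continuous.Icc_extend'.sub (primitive T E z).continuous.Icc_extend').continuousOn
      continuousOn_const
  have hval (t : Icc (0 : ℝ) T) : y t - primitive T E z t = c := by
    simpa only [Pi.sub_apply, IccExtend_val] using heq t.2
  rw [← sub_eq_iff_eq_add, hval t, ← hval ⟨0, left_mem_Icc.2 hT.le⟩, primitive_apply,
    intervalIntegral.integral_same, sub_zero]

theorem primitive_injective (hT : 0 ≤ T) : Function.Injective (primitive T E) := by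
  refine (injective_iff_map_eq_zero _).2 fun x hx => ?_
  have hweak : HasWeakTimeDeriv T (IccExtend hT (0 : C(Icc (0 : ℝ) T, E))) x :=
    hasWeakTimeDeriv_of_eq_add_primitive hT (c := 0) fun t => by rw [hx, zero_add]
  have hae := isOpen_Ioo.ae_eq_zero_of_integral_contDiff_smul_eq_zero (μ := volume)
    (U := Ioo 0 T) (IntegrableOn.locallyIntegrableOn (integrable_coeFn x)) fun φ hφ hc hs => ?_
  · have hzero : x =ᵐ[timeMeasure T] 0 := (ae_restrict_iff' measurableSet_Ioo).2 hae
    exact (Lp.eq_zero_iff_ae_eq_zero).2 hzero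
  · rw [← setIntegral_eq_integral_of_forall_compl_eq_zero (s := Ioo 0 T) fun t ht => by
      rw [image_eq_zero_of_notMem_tsupport (mt (@hs t) ht), zero_smul]]
    simpa [IccExtend] using (hweak φ hφ hc hs).symm

end WeakDerivative

section TimeReversal

variable {E F : Type*} [NormedAddCommGroup E] [NormedSpace ℝ E]
  [NormedAddCommGroup F] [NormedSpace ℝ F] {T : ℝ}

theorem measurePreserving_sub_left_timeMeasure (T : ℝ) :
    MeasurePreserving (fun t => T - t) (timeMeasure T) (timeMeasure T) := by
  have h := (volume.measurePreserving_sub_left T).restrict_preimage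
    (measurableSet_Ioo (a := (0 : ℝ)) (b := T))
  rwa [Set.preimage_const_sub_Ioo, sub_self, sub_zero] at h

/-- Time reversal `x ↦ x (T - ·)` on `L²(0,T;E)`. -/
noncomputable def timeReversal (T : ℝ) (E : Type*) [NormedAddCommGroup E] [NormedSpace ℝ E] :
    L2 T E →ₗᵢ[ℝ] L2 T E :=
  Lp.compMeasurePreservingₗᵢ ℝ (fun t => T - t) (measurePreserving_sub_left_timeMeasure T)

theorem coeFn_timeReversal (x : L2 T E) :
    timeReversal T E x =ᵐ[timeMeasure T] fun t => x (T - t) :=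
  Lp.coeFn_compMeasurePreserving x (measurePreserving_sub_left_timeMeasure T)

theorem ae_comp_sub_left {p : ℝ → Prop} (h : ∀ᵐ t ∂timeMeasure T, p t) :
    ∀ᵐ t ∂timeMeasure T, p (T - t) :=
  (measurePreserving_sub_left_timeMeasure T).quasiMeasurePreserving.ae h

theorem pointwise_timeReversal (M : E →L[ℝ] F) (x : L2 T E) :
    pointwise T M (timeReversal T E x) = timeReversal T F (pointwise T M x) := by
  refine Lp.ext ?_
  filter_upwards [M.coeFn_compLpL (timeReversal T E x), coeFn_timeReversal x,
    coeFn_timeReversal (pointwise T M x), ae_comp_sub_left (M.coeFn_compLpL x)]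
    with t h1 h2 h3 h4
  rw [h1, h2, h3, h4]

theorem timeReversal_timeReversal (x : L2 T E) : timeReversal T E (timeReversal T E x) = x := by
  refine Lp.ext ?_
  filter_upwards [coeFn_timeReversal (timeReversal T E x), ae_comp_sub_left (coeFn_timeReversal x)]
    with t h1 h2
  rw [h1, h2, sub_sub_cancel]

theorem primitive_timeReversal (hT : 0 ≤ T) (x : L2 T E) (t : Icc (0 : ℝ) T) :
    primitive T E (timeReversal T E x) t = primitive T E x ⟨T, right_mem_Icc.2 hT⟩ -
      IccExtend hT (primitive T E x) (T - t) := by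
  have ht : T - t ∈ Icc 0 T := ⟨sub_nonneg.2 t.2.2, sub_le_self T t.2.1⟩
  have hinteg := (integrable_coeFn x)
  rw [IccExtend_of_mem _ _ ht, primitive_apply, primitive_apply, primitive_apply,
    intervalIntegral.integral_interval_sub_left hinteg.intervalIntegrable hinteg.intervalIntegrable,
    intervalIntegral.integral_congr_ae_restrict (ae_restrict_of_ae (coeFn_timeReversal x)),
    intervalIntegral_timeMeasure le_rfl t.2.1 t.2.2,
    intervalIntegral_timeMeasure ht.1 ht.2 le_rfl, intervalIntegral.integral_comp_sub_left,
    sub_zero]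

variable {X : Type*} [NormedAddCommGroup X] [InnerProductSpace ℝ X] [CompleteSpace X]

theorem inner_toL2_primitive (hT : 0 ≤ T) (x y : L2 T X) :
    ⟪y, toL2 hT X (primitive T X x)⟫ =
      ⟪timeReversal T X (toL2 hT X (primitive T X (timeReversal T X y))), x⟫ := by
  have hparts := integral_bilin_primitive hT (innerSL ℝ) y x
  set Y := primitive T X y ⟨T, right_mem_Icc.2 hT⟩
  have hreversed : timeReversal T X (toL2 hT X (primitive T X (timeReversal T X y)))
      =ᵐ[timeMeasure T] fun t => Y - toL2 hT X (primitive T X y) t := by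
    filter_upwards [coeFn_timeReversal (toL2 hT X (primitive T X (timeReversal T X y))),
      ae_comp_sub_left (coeFn_toL2 hT (primitive T X (timeReversal T X y))),
      coeFn_toL2 hT (primitive T X y), ae_comp_sub_left (ae_restrict_mem measurableSet_Ioo)]
      with t h1 h2 h3 ht
    rw [h1, h2, h3, IccExtend_of_mem _ _ (Ioo_subset_Icc_self ht), primitive_timeReversal hT,
      sub_sub_cancel]
  have hY : ∫ t, ⟪Y, x t⟫ ∂timeMeasure T = ⟪Y, primitive T X x ⟨T, right_mem_Icc.2 hT⟩⟫ := by
    rw [integral_inner (integrable_coeFn x), primitive_apply,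
      intervalIntegral_timeMeasure le_rfl hT le_rfl, setIntegral_Ioo_eq_intervalIntegral hT]
  rw [L2.inner_def, L2.inner_def, integral_congr_ae (hreversed.mono fun t ht =>
    congrArg (⟪·, x t⟫) ht)]
  simp only [inner_sub_left]
  rw [integral_sub ((integrable_coeFn x).const_inner Y) (L2.integrable_inner _ x), hY]
  exact eq_sub_of_add_eq' hparts

end TimeReversal

section Gronwall

theorem le_exp_mul_add_integral_of_hasDerivAt_le {Φ Φ' g : ℝ → ℝ} {k : ℝ} (hk : 0 ≤ k)
    (hΦ : ∀ t, HasDerivAt Φ (Φ' t) t) (hg : Continuous g) (hg0 : ∀ t, 0 ≤ g t)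
    (hle : ∀ t, 0 ≤ t → Φ' t ≤ k * Φ t + g t) {t : ℝ} (ht : 0 ≤ t) :
    Φ t ≤ Real.exp (k * t) * (Φ 0 + ∫ s in (0 : ℝ)..t, g s) := by
  set G : ℝ → ℝ := fun t => Real.exp (-(k * t)) * Φ t - ∫ s in (0 : ℝ)..t, g s with hG
  have hG' (t : ℝ) : HasDerivAt G
      (Real.exp (-(k * t)) * -(k * 1) * Φ t + Real.exp (-(k * t)) * Φ' t - g t) t :=
    ((((hasDerivAt_id t).const_mul k).neg.exp).mul (hΦ t)).sub
      (hg.integral_hasStrictDerivAt 0 t).hasDerivAt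
  have hanti : AntitoneOn G (Ici 0) := by
    refine antitoneOn_of_deriv_nonpos (convex_Ici 0)
      (fun t _ => (hG' t).continuousAt.continuousWithinAt)
      (fun t _ => (hG' t).differentiableAt.differentiableWithinAt) fun t ht => ?_
    rw [interior_Ici, mem_Ioi] at ht
    have hexp : Real.exp (-(k * t)) ≤ 1 :=
      Real.exp_le_one_iff.2 (neg_nonpos.2 (mul_nonneg hk ht.le))
    have hmul := mul_le_mul_of_nonneg_left (hle t ht.le) (Real.exp_pos (-(k * t))).le
    have hgle := mul_le_mul_of_nonneg_right hexp (hg0 t)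
    rw [(hG' t).deriv]
    linarith
  have hGt : G t ≤ G 0 := hanti (mem_Ici.2 le_rfl) (mem_Ici.2 ht) ht
  simp only [hG, mul_zero, neg_zero, Real.exp_zero, one_mul, intervalIntegral.integral_same,
    sub_zero] at hGt
  calc Φ t = Real.exp (k * t) * (Real.exp (-(k * t)) * Φ t) := by
        rw [← mul_assoc, ← Real.exp_add, add_neg_cancel, Real.exp_zero, one_mul]
    _ ≤ Real.exp (k * t) * (Φ 0 + ∫ s in (0 : ℝ)..t, g s) := by
        gcongr
        linarith

end Gronwall

section EnergyEstimate

variable {V H : Type*} [NormedAddCommGroup V] [InnerProductSpace ℝ V] [CompleteSpace V]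
  [NormedAddCommGroup H] [InnerProductSpace ℝ H]

/-- Gårding's inequality for an operator `a` on `V`, relative to `ι : V → H`. Through the Riesz
isomorphism of `V`, `a` stands for an operator from `V` to its dual. -/
structure GardingInequality (ι : V →L[ℝ] H) (a : V →L[ℝ] V) (α ρ : ℝ) : Prop where
  α_pos : 0 < α
  ρ_nonneg : 0 ≤ ρ
  le : ∀ v, α * ‖v‖ ^ 2 ≤ -⟪a v, v⟫ + ρ * ‖ι v‖ ^ 2

variable {ι : V →L[ℝ] H} {a : V →L[ℝ] V} {α ρ : ℝ}

theorem GardingInequality.adjoint (ha : GardingInequality ι a α ρ) :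
    GardingInequality ι (a†) α ρ where
  α_pos := ha.α_pos
  ρ_nonneg := ha.ρ_nonneg
  le v := by
    rw [ContinuousLinearMap.adjoint_inner_left, real_inner_comm]
    exact ha.le v

variable [CompleteSpace H]

theorem GardingInequality.two_mul_inner_le (ha : GardingInequality ι a α ρ) (v w : V) :
    2 * ⟪ι v, ι w⟫ ≤ 2 * ρ * ‖ι v‖ ^ 2 - α * ‖v‖ ^ 2 + α⁻¹ * ‖(ι†) (ι w) - a v‖ ^ 2 := by
  have hsplit : ⟪ι v, ι w⟫ = ⟪v, (ι†) (ι w) - a v⟫ + ⟪a v, v⟫ := by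
    rw [inner_sub_right, ContinuousLinearMap.adjoint_inner_right, real_inner_comm (a v) v]
    ring
  have hcs := real_inner_le_norm v ((ι†) (ι w) - a v)
  have hyoung : 2 * (‖v‖ * ‖(ι†) (ι w) - a v‖) ≤
      α * ‖v‖ ^ 2 + α⁻¹ * ‖(ι†) (ι w) - a v‖ ^ 2 := by
    have hα := ha.α_pos
    have hsq := mul_nonneg hα.le (sq_nonneg (‖v‖ - α⁻¹ * ‖(ι†) (ι w) - a v‖))
    field_simp at hsq ⊢
    linarith
  linarith [ha.le v]

theorem GardingInequality.energy_le (ha : GardingInequality ι a α ρ) {v v' : ℝ → V}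
    (hv : ∀ t, HasDerivAt v (v' t) t) (hv' : Continuous v') {t : ℝ} (ht : 0 ≤ t) :
    ‖ι (v t)‖ ^ 2 + α * ∫ s in (0 : ℝ)..t, ‖v s‖ ^ 2 ≤
      Real.exp (2 * ρ * t) *
        (‖ι (v 0)‖ ^ 2 + ∫ s in (0 : ℝ)..t, α⁻¹ * ‖(ι†) (ι (v' s)) - a (v s)‖ ^ 2) := by
  have hα := ha.α_pos
  have hvc : Continuous v := continuous_iff_continuousAt.2 fun t => (hv t).continuousAt
  have henergy (t : ℝ) : HasDerivAt
      (fun t => ‖ι (v t)‖ ^ 2 + α * ∫ s in (0 : ℝ)..t, ‖v s‖ ^ 2)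
      (2 * ⟪ι (v t), ι (v' t)⟫ + α * ‖v t‖ ^ 2) t :=
    ((ι.hasFDerivAt.comp_hasDerivAt t (hv t)).norm_sq).add
      (((hvc.norm.pow 2).integral_hasStrictDerivAt 0 t).hasDerivAt.const_mul α)
  have hgronwall := le_exp_mul_add_integral_of_hasDerivAt_le
    (g := fun s => α⁻¹ * ‖(ι†) (ι (v' s)) - a (v s)‖ ^ 2)
    (mul_nonneg zero_le_two ha.ρ_nonneg) henergy (by fun_prop) (fun t => by positivity)
    (fun t ht => ?_) ht
  · simpa only [intervalIntegral.integral_same, mul_zero, add_zero] using hgronwall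
  · have hdissipation : 0 ≤ 2 * ρ * (α * ∫ s in (0 : ℝ)..t, ‖v s‖ ^ 2) :=
      mul_nonneg (mul_nonneg zero_le_two ha.ρ_nonneg)
        (mul_nonneg hα.le (intervalIntegral.integral_nonneg ht fun _ _ => sq_nonneg _))
    linarith [ha.two_mul_inner_le (v t) (v' t)]

end EnergyEstimate

section Parabolic

theorem pointwise_toL2_primitive {E F : Type*} [NormedAddCommGroup E] [NormedSpace ℝ E]
    [CompleteSpace E] [NormedAddCommGroup F] [NormedSpace ℝ F] [CompleteSpace F] {T : ℝ}
    (hT : 0 ≤ T) (M : E →L[ℝ] F) (x : L2 T E) :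
    pointwise T M (toL2 hT E (primitive T E x)) = toL2 hT F (primitive T F (pointwise T M x)) := by
  rw [pointwise_toL2]
  exact congrArg _ (ContinuousMap.ext fun t => (primitive_pointwise M x t).symm)

variable {V H : Type*} [NormedAddCommGroup V] [InnerProductSpace ℝ V]
  [NormedAddCommGroup H] [InnerProductSpace ℝ H]

theorem pointwise_injective {T : ℝ} {M : V →L[ℝ] H} (hM : Function.Injective M) :
    Function.Injective (pointwise T M) := by
  refine (injective_iff_map_eq_zero _).2 fun x hx => Lp.eq_zero_iff_ae_eq_zero.2 ?_
  filter_upwards [M.coeFn_compLpL x, Lp.eq_zero_iff_ae_eq_zero.1 hx] with t h1 h2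
  exact (injective_iff_map_eq_zero M).1 hM _ (h1.symm.trans h2)

variable [CompleteSpace V] [CompleteSpace H]

theorem inner_pointwise_right {T : ℝ} (M : V →L[ℝ] H) (x : L2 T V) (y : L2 T H) :
    ⟪y, pointwise T M x⟫ = ⟪pointwise T (M†) y, x⟫ := by
  rw [L2.inner_def, L2.inner_def]
  refine integral_congr_ae ?_
  filter_upwards [M.coeFn_compLpL x, (M†).coeFn_compLpL y] with t h1 h2
  rw [h1, h2, ContinuousLinearMap.adjoint_inner_left]

theorem adjoint_comp_self_injective {M : V →L[ℝ] H} (hM : Function.Injective M) :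
    Function.Injective (M† ∘L M) := by
  refine (injective_iff_map_eq_zero _).2 fun x hx => (injective_iff_map_eq_zero M).1 hM x ?_
  rw [← norm_eq_zero, ← sq_eq_zero_iff, ContinuousLinearMap.apply_norm_sq_eq_inner_adjoint_left,
    hx, inner_zero_left, map_zero]

/-- The operator `x ↦ ι†ι x - ∫₀ᵗ a x` on `L²(0,T;V)`: with `v` the primitive of `x`, this is
`ι†ι v̇ - a v`. -/
noncomputable def parabolicMap {T : ℝ} (hT : 0 ≤ T) (ι : V →L[ℝ] H) (a : V →L[ℝ] V) :
    L2 T V →L[ℝ] L2 T V :=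
  pointwise T (ι† ∘L ι) - toL2 hT V ∘L primitive T V ∘L pointwise T a

variable {T : ℝ} (hT : 0 ≤ T) {ι : V →L[ℝ] H} {a : V →L[ℝ] V} {α ρ : ℝ}

theorem parabolicMap_apply (x : L2 T V) : parabolicMap hT ι a x =
    pointwise T (ι† ∘L ι) x - toL2 hT V (primitive T V (pointwise T a x)) := rfl

theorem inner_parabolicMap (x y : L2 T V) : ⟪y, parabolicMap hT ι a x⟫ =
    ⟪timeReversal T V (parabolicMap hT ι (a†) (timeReversal T V y)), x⟫ := by
  rw [parabolicMap_apply, parabolicMap_apply, inner_sub_right, map_sub, inner_sub_left,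
    ← pointwise_timeReversal, timeReversal_timeReversal, inner_pointwise_right,
    ContinuousLinearMap.adjoint_comp, ContinuousLinearMap.adjoint_adjoint,
    ← pointwise_toL2_primitive, inner_pointwise_right, inner_toL2_primitive,
    pointwise_timeReversal]

theorem parabolicMap_injective (hι : Function.Injective ι) (ha : GardingInequality ι a α ρ) :
    Function.Injective (parabolicMap hT ι a) := by
  refine (injective_iff_map_eq_zero _).2 fun x hx => ?_
  rw [parabolicMap_apply, sub_eq_zero, ← pointwise_toL2_primitive] at hx
  set z := primitive T V x
  set v : ℝ → V := fun t => ∫ s in (0 : ℝ)..t, IccExtend hT z s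
  have heq (t : Icc (0 : ℝ) T) : (ι†) (ι (z t)) = a (v t) := by
    have h := congrArg (fun y => primitive T V y t) hx
    rwa [primitive_pointwise, primitive_pointwise, primitive_toL2] at h
  have hv (t : Icc (0 : ℝ) T) : v t = 0 := by
    have henergy := ha.energy_le (hasDerivAt_integral_IccExtend hT z)
      z.continuous.Icc_extend' t.2.1
    have hforcing : ∫ s in (0 : ℝ)..t, α⁻¹ * ‖(ι†) (ι (IccExtend hT z s)) - a (v s)‖ ^ 2 = 0 := by
      refine intervalIntegral.integral_zero_ae (.of_forall fun s hs => ?_)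
      rw [uIoc_of_le t.2.1] at hs
      have hs : s ∈ Icc 0 T := ⟨hs.1.le, hs.2.trans t.2.2⟩
      rw [IccExtend_of_mem _ _ hs, heq ⟨s, hs⟩, sub_self, norm_zero, sq, mul_zero, mul_zero]
    have hnonneg : 0 ≤ α * ∫ s in (0 : ℝ)..t, ‖v s‖ ^ 2 :=
      mul_nonneg ha.α_pos.le (intervalIntegral.integral_nonneg t.2.1 fun _ _ => sq_nonneg _)
    rw [hforcing, intervalIntegral.integral_same, map_zero, norm_zero, sq, sq, mul_zero, add_zero,
      mul_zero] at henergy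
    refine (injective_iff_map_eq_zero ι).1 hι _ (norm_eq_zero.1 (sq_eq_zero_iff.1 ?_))
    nlinarith [sq_nonneg ‖ι (v t)‖]
  have hz : toL2 hT V z = 0 := primitive_injective hT <| ContinuousMap.ext fun t => by
    rw [primitive_toL2, map_zero]
    exact hv t
  rw [hz, map_zero] at hx
  exact (injective_iff_map_eq_zero _).1
    (pointwise_injective (adjoint_comp_self_injective hι)) x hx

theorem denseRange_parabolicMap (hι : Function.Injective ι) (ha : GardingInequality ι a α ρ) :
    DenseRange (parabolicMap hT ι a) := by
  refine (parabolicMap hT ι a).range.dense_iff_topologicalClosure_eq_top.2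
    (Submodule.topologicalClosure_eq_top_iff.2 ((Submodule.eq_bot_iff _).2 fun y hy => ?_))
  have hzero : timeReversal T V (parabolicMap hT ι (a†) (timeReversal T V y)) = 0 :=
    ext_inner_right ℝ fun x => by
      rw [← inner_parabolicMap, inner_zero_left]
      exact (Submodule.mem_orthogonal' _ _).1 hy _ ⟨x, rfl⟩
  refine (injective_iff_map_eq_zero _).1 (timeReversal T V).injective y
    ((injective_iff_map_eq_zero _).1 (parabolicMap_injective hT hι ha.adjoint) _
      ((injective_iff_map_eq_zero _).1 (timeReversal T V).injective _ hzero))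

end Parabolic

section SolutionGraph

theorem norm_sq_eq_integral {X : Type*} [NormedAddCommGroup X] [InnerProductSpace ℝ X] {T : ℝ}
    (x : L2 T X) : ‖x‖ ^ 2 = ∫ t, ‖x t‖ ^ 2 ∂timeMeasure T := by
  rw [← real_inner_self_eq_norm_sq, L2.inner_def]
  simp only [real_inner_self_eq_norm_sq]

variable {V H : Type*} [NormedAddCommGroup V] [InnerProductSpace ℝ V] [CompleteSpace V]
  [NormedAddCommGroup H] [InnerProductSpace ℝ H] [CompleteSpace H]
  {T : ℝ} (hT : 0 ≤ T) (ι : V →L[ℝ] H) (a : V →L[ℝ] V)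

/-- The graph of the data-to-solution relation of `(ι†y)˙ = a v + F`, `y(0) = y₀`, with `ι v = y`
almost everywhere: the pairs of data `(F, y₀)` and solutions `(v, y)`, the equation being written
in integrated form. -/
noncomputable def solutionGraph :
    Submodule ℝ ((L2 T V × H) × (L2 T V × C(Icc (0 : ℝ) T, H))) :=
  (pointwise T ι ∘L .fst ℝ _ _ ∘L .snd ℝ _ _ - toL2 hT H ∘L .snd ℝ _ _ ∘L .snd ℝ _ _ :
      ((L2 T V × H) × (L2 T V × C(Icc (0 : ℝ) T, H))) →L[ℝ] L2 T H).ker ⊓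
    ((ι†).compLeftContinuous ℝ (Icc (0 : ℝ) T) ∘L .snd ℝ _ _ ∘L .snd ℝ _ _ -
      (ContinuousLinearMap.const ℝ (Icc (0 : ℝ) T) ∘L ι† ∘L .snd ℝ _ _ ∘L .fst ℝ _ _ +
        primitive T V ∘L (pointwise T a ∘L .fst ℝ _ _ ∘L .snd ℝ _ _ + .fst ℝ _ _ ∘L .fst ℝ _ _)) :
      ((L2 T V × H) × (L2 T V × C(Icc (0 : ℝ) T, H))) →L[ℝ] C(Icc (0 : ℝ) T, V)).ker

theorem isClosed_solutionGraph :
    IsClosed (solutionGraph hT ι a : Set ((L2 T V × H) × (L2 T V × C(Icc (0 : ℝ) T, H)))) :=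
  (ContinuousLinearMap.isClosed_ker _).inter (ContinuousLinearMap.isClosed_ker _)

variable (V) in
/-- The `C¹` curve `t ↦ v₀ + ∫₀ᵗ x` with derivative `x` and initial value `v₀`. -/
noncomputable def regularCurve : C(Icc (0 : ℝ) T, V) × V →L[ℝ] C(Icc (0 : ℝ) T, V) :=
  ContinuousLinearMap.const ℝ _ ∘L .snd ℝ _ _ + primitive T V ∘L toL2 hT V ∘L .fst ℝ _ _

/-- The solution given by a `C¹` curve with values in `V`. -/
noncomputable def regularSolution :
    C(Icc (0 : ℝ) T, V) × V →L[ℝ] L2 T V × C(Icc (0 : ℝ) T, H) :=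
  (toL2 hT V).prod (ι.compLeftContinuous ℝ (Icc (0 : ℝ) T)) ∘L regularCurve V hT

/-- The data `(ι†ι v̇ - a v, ι v(0))` solved by a `C¹` curve `v` with values in `V`. -/
noncomputable def regularData : C(Icc (0 : ℝ) T, V) × V →L[ℝ] L2 T V × H :=
  (pointwise T (ι† ∘L ι) ∘L toL2 hT V ∘L .fst ℝ _ _ -
    pointwise T a ∘L toL2 hT V ∘L regularCurve V hT).prod (ι ∘L .snd ℝ _ _)

variable {hT ι a}

theorem mem_solutionGraph {F : L2 T V} {y₀ : H} {v : L2 T V} {y : C(Icc (0 : ℝ) T, H)} :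
    ((F, y₀), (v, y)) ∈ solutionGraph hT ι a ↔ pointwise T ι v = toL2 hT H y ∧
      ∀ t, (ι†) (y t) = (ι†) y₀ + primitive T V (pointwise T a v + F) t :=
  and_congr sub_eq_zero (sub_eq_zero.trans ContinuousMap.ext_iff)

theorem regular_mem_solutionGraph (w : C(Icc (0 : ℝ) T, V) × V) :
    (regularData hT ι a w, regularSolution hT ι w) ∈ solutionGraph hT ι a := by
  refine mem_solutionGraph.2 ⟨pointwise_toL2 hT ι _, fun t => ?_⟩
  have hF : pointwise T a (regularSolution hT ι w).1 + (regularData hT ι a w).1 =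
      pointwise T (ι† ∘L ι) (toL2 hT V w.1) := add_sub_cancel _ _
  change (ι† ∘L ι) (w.2 + primitive T V (toL2 hT V w.1) t) = (ι† ∘L ι) w.2 +
    primitive T V (pointwise T a (regularSolution hT ι w).1 + (regularData hT ι a w).1) t
  rw [hF, primitive_pointwise, map_add]

theorem coeFn_regularData (w : C(Icc (0 : ℝ) T, V) × V) :
    (regularData hT ι a w).1 =ᵐ[timeMeasure T] fun t =>
      (ι†) (ι (IccExtend hT w.1 t)) - a (IccExtend hT (regularCurve V hT w) t) := by
  filter_upwards [Lp.coeFn_sub (pointwise T (ι† ∘L ι) (toL2 hT V w.1))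
      (pointwise T a (toL2 hT V (regularCurve V hT w))),
    (ι† ∘L ι).coeFn_compLpL (toL2 hT V w.1), coeFn_toL2 hT w.1,
    a.coeFn_compLpL (toL2 hT V (regularCurve V hT w)), coeFn_toL2 hT (regularCurve V hT w)]
    with t h1 h2 h3 h4 h5
  rw [h3] at h2
  rw [h5] at h4
  exact h1.trans (congrArg₂ (· - ·) h2 h4)

theorem regularData_apply (x : C(Icc (0 : ℝ) T, V)) (v₀ : V) : regularData hT ι a (x, v₀) =
    (parabolicMap hT ι a (toL2 hT V x) - pointwise T a (toL2 hT V (.const _ v₀)), ι v₀) := by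
  refine Prod.ext ?_ rfl
  rw [parabolicMap_apply, ← pointwise_toL2_primitive, sub_sub, ← map_add, ← map_add, add_comm]
  rfl

variable {α ρ : ℝ}

theorem denseRange_regularData (hι : Function.Injective ι) (hdense : DenseRange ι)
    (ha : GardingInequality ι a α ρ) : DenseRange (regularData hT ι a) := by
  set S := (regularData hT ι a).range.topologicalClosure
  have hmem (w : C(Icc (0 : ℝ) T, V) × V) : regularData hT ι a w ∈ S :=
    Submodule.le_topologicalClosure _ ⟨w, rfl⟩
  have hclosed : IsClosed (S : Set (L2 T V × H)) := Submodule.isClosed_topologicalClosure _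
  have hforcing (F : L2 T V) : (F, 0) ∈ S := by
    refine ((denseRange_parabolicMap hT hι ha).comp (denseRange_toL2 hT)
      (parabolicMap hT ι a).continuous).induction_on (p := fun F => (F, 0) ∈ S) F
      (hclosed.preimage (by fun_prop)) fun x => ?_
    have h := hmem (x, 0)
    rwa [regularData_apply, map_zero, show ContinuousMap.const (Icc (0 : ℝ) T) (0 : V) = 0 from rfl,
      map_zero, map_zero, sub_zero] at h
  have hinitial (h : H) : (0, h) ∈ S := by
    refine hdense.induction_on (p := fun h => (0, h) ∈ S) h
      (hclosed.preimage (by fun_prop)) fun v₀ => ?_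
    have h := sub_mem (hmem (0, v₀)) (hforcing (regularData hT ι a (0, v₀)).1)
    rwa [regularData_apply, Prod.mk_sub_mk, sub_self, sub_zero] at h
  refine (regularData hT ι a).range.dense_iff_topologicalClosure_eq_top.2
    ((Submodule.eq_top_iff').2 fun d => ?_)
  simpa only [Prod.mk_add_mk, add_zero, zero_add] using add_mem (hforcing d.1) (hinitial d.2)

omit [CompleteSpace V] in
theorem IccExtend_regularCurve (w : C(Icc (0 : ℝ) T, V) × V) {s : ℝ} (hs : s ∈ Icc 0 T) :
    IccExtend hT (regularCurve V hT w) s = w.2 + ∫ r in (0 : ℝ)..s, IccExtend hT w.1 r :=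
  (IccExtend_of_mem _ _ hs).trans (congrArg (w.2 + ·) (primitive_toL2 hT w.1 ⟨s, hs⟩))

theorem integral_norm_sq_regularData_le (w : C(Icc (0 : ℝ) T, V) × V) (t : Icc (0 : ℝ) T) :
    ∫ s in (0 : ℝ)..t, ‖(ι†) (ι (IccExtend hT w.1 s)) -
      a (w.2 + ∫ r in (0 : ℝ)..s, IccExtend hT w.1 r)‖ ^ 2 ≤ ‖(regularData hT ι a w).1‖ ^ 2 := by
  set forcing : ℝ → ℝ := fun s => ‖(ι†) (ι (IccExtend hT w.1 s)) -
    a (w.2 + ∫ r in (0 : ℝ)..s, IccExtend hT w.1 r)‖ ^ 2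
  have hdata : (fun s => ‖(regularData hT ι a w).1 s‖ ^ 2) =ᵐ[timeMeasure T] forcing := by
    filter_upwards [coeFn_regularData (hT := hT) (ι := ι) (a := a) w,
      ae_restrict_mem measurableSet_Ioo] with s hs hsT
    rw [hs, IccExtend_regularCurve w (Ioo_subset_Icc_self hsT)]
  have _ : Continuous (IccExtend hT w.1) := w.1.continuous.Icc_extend'
  have _ : Continuous fun s => ∫ r in (0 : ℝ)..s, IccExtend hT w.1 r :=
    intervalIntegral.continuous_primitive
      (fun _ _ => w.1.continuous.Icc_extend'.intervalIntegrable _ _) 0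
  have hforcing : Continuous forcing := by fun_prop
  rw [norm_sq_eq_integral, integral_congr_ae hdata, setIntegral_Ioo_eq_intervalIntegral hT]
  exact intervalIntegral.integral_mono_interval le_rfl t.2.1 t.2.2
    (ae_of_all _ fun _ => sq_nonneg _) (hforcing.intervalIntegrable _ _)

theorem norm_sq_add_integral_regularCurve_le (ha : GardingInequality ι a α ρ)
    (w : C(Icc (0 : ℝ) T, V) × V) (t : Icc (0 : ℝ) T) :
    ‖ι (regularCurve V hT w t)‖ ^ 2 +
      α * ∫ s in (0 : ℝ)..t, ‖IccExtend hT (regularCurve V hT w) s‖ ^ 2 ≤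
    Real.exp (2 * ρ * T) *
      (‖(regularData hT ι a w).2‖ ^ 2 + α⁻¹ * ‖(regularData hT ι a w).1‖ ^ 2) := by
  have henergy := ha.energy_le (fun t => (hasDerivAt_integral_IccExtend hT w.1 t).const_add w.2)
    w.1.continuous.Icc_extend' t.2.1
  rw [intervalIntegral.integral_same, add_zero, intervalIntegral.integral_const_mul] at henergy
  have hcurve : ∫ s in (0 : ℝ)..t, ‖IccExtend hT (regularCurve V hT w) s‖ ^ 2 =
      ∫ s in (0 : ℝ)..t, ‖w.2 + ∫ r in (0 : ℝ)..s, IccExtend hT w.1 r‖ ^ 2 := by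
    refine intervalIntegral.integral_congr fun s hs => ?_
    rw [uIcc_of_le t.2.1] at hs
    exact congrArg (‖·‖ ^ 2) (IccExtend_regularCurve w ⟨hs.1, hs.2.trans t.2.2⟩)
  have hα := ha.α_pos
  have hρ := ha.ρ_nonneg
  rw [hcurve, ← IccExtend_val hT (regularCurve V hT w) t, IccExtend_regularCurve w t.2]
  refine henergy.trans ?_
  gcongr
  · exact add_nonneg (sq_nonneg _) (mul_nonneg (inv_pos.2 hα).le
      (intervalIntegral.integral_nonneg t.2.1 fun _ _ => sq_nonneg _))
  · exact t.2.2
  · exact le_rfl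
  · exact integral_norm_sq_regularData_le w t

/-- The constant in the a priori estimate. -/
noncomputable def stabilityConst (α ρ T : ℝ) : ℝ := (1 + α⁻¹) * Real.exp (ρ * T)

omit [CompleteSpace V] [CompleteSpace H] in
theorem stabilityConst_nonneg (ha : GardingInequality ι a α ρ) : 0 ≤ stabilityConst α ρ T := by
  have hα := ha.α_pos
  rw [stabilityConst]
  positivity

theorem norm_regularSolution_le (ha : GardingInequality ι a α ρ)
    (w : C(Icc (0 : ℝ) T, V) × V) :
    ‖regularSolution hT ι w‖ ≤ stabilityConst α ρ T * ‖regularData hT ι a w‖ := by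
  have hα := inv_pos.2 ha.α_pos
  set d := regularData hT ι a w
  set K := Real.exp (2 * ρ * T) * (‖d.2‖ ^ 2 + α⁻¹ * ‖d.1‖ ^ 2)
  have hK : (1 + α⁻¹) * K ≤ (stabilityConst α ρ T * ‖d‖) ^ 2 := by
    have hexp : Real.exp (2 * ρ * T) = Real.exp (ρ * T) ^ 2 := by
      rw [← Real.exp_nat_mul]
      ring_nf
    calc (1 + α⁻¹) * K ≤ (1 + α⁻¹) * (Real.exp (2 * ρ * T) * (‖d‖ ^ 2 + α⁻¹ * ‖d‖ ^ 2)) := by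
          simp only [K]
          gcongr
          exacts [norm_snd_le d, norm_fst_le d]
      _ = (stabilityConst α ρ T * ‖d‖) ^ 2 := by
          rw [stabilityConst, hexp]
          ring
  have henergy := norm_sq_add_integral_regularCurve_le (hT := hT) ha w
  have hv : ‖toL2 hT V (regularCurve V hT w)‖ ^ 2 ≤ α⁻¹ * K := by
    rw [← div_eq_inv_mul, le_div_iff₀' ha.α_pos, norm_sq_eq_integral, integral_congr_ae
      ((coeFn_toL2 hT _).mono fun t ht => congrArg (‖·‖ ^ 2) ht),
      setIntegral_Ioo_eq_intervalIntegral hT]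
    exact (le_add_of_nonneg_left (sq_nonneg _)).trans (henergy ⟨T, right_mem_Icc.2 hT⟩)
  have hy (t : Icc (0 : ℝ) T) : ‖ι (regularCurve V hT w t)‖ ^ 2 ≤ K :=
    (le_add_of_nonneg_right (mul_nonneg ha.α_pos.le
      (intervalIntegral.integral_nonneg t.2.1 fun _ _ => sq_nonneg _))).trans (henergy t)
  have hKnonneg : 0 ≤ K := by positivity
  have hM := mul_nonneg (stabilityConst_nonneg (T := T) ha) (norm_nonneg d)
  have hone : K ≤ (1 + α⁻¹) * K := le_mul_of_one_le_left hKnonneg (le_add_of_nonneg_right hα.le)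
  have hinv : α⁻¹ * K ≤ (1 + α⁻¹) * K :=
    mul_le_mul_of_nonneg_right (le_add_of_nonneg_left zero_le_one) hKnonneg
  exact max_le (le_of_sq_le_sq (hv.trans (hinv.trans hK)) hM)
    ((ContinuousMap.norm_le _ hM).2 fun t => le_of_sq_le_sq ((hy t).trans (hone.trans hK)) hM)

theorem pointwise_comp {E F G : Type*} [NormedAddCommGroup E] [NormedSpace ℝ E]
    [NormedAddCommGroup F] [NormedSpace ℝ F] [NormedAddCommGroup G] [NormedSpace ℝ G]
    (M : F →L[ℝ] G) (N : E →L[ℝ] F) (x : L2 T E) :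
    pointwise T (M ∘L N) x = pointwise T M (pointwise T N x) := by
  refine Lp.ext ?_
  filter_upwards [(M ∘L N).coeFn_compLpL x, N.coeFn_compLpL x,
    M.coeFn_compLpL (pointwise T N x)] with t h1 h2 h3
  rw [h1, h3, h2]
  rfl

theorem adjoint_injective_of_denseRange (hdense : DenseRange ι) : Function.Injective (ι†) := by
  have h : (ι†).ker = ⊥ := by
    rw [← ContinuousLinearMap.orthogonal_range]
    exact Submodule.topologicalClosure_eq_top_iff.1
      (Submodule.dense_iff_topologicalClosure_eq_top.1 hdense)
  exact LinearMap.ker_eq_bot.1 h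

theorem solutionGraph_snd_eq_zero (hι : Function.Injective ι) (hdense : DenseRange ι)
    (ha : GardingInequality ι a α ρ) {s : L2 T V × C(Icc (0 : ℝ) T, H)}
    (hs : (0, s) ∈ solutionGraph hT ι a) : s = 0 := by
  obtain ⟨v, y⟩ := s
  obtain ⟨hvy, heq⟩ := mem_solutionGraph.1 hs
  simp only [map_zero, zero_add, add_zero] at heq
  have hιy : ((ι†) : C(H, V)).comp y = primitive T V (pointwise T a v) := ContinuousMap.ext heq
  have hv : v = 0 := by
    refine (injective_iff_map_eq_zero _).1 (parabolicMap_injective hT hι ha) v ?_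
    rw [parabolicMap_apply, ← hιy, ← pointwise_toL2, ← hvy, pointwise_comp, sub_self]
  have hy : y = 0 := ContinuousMap.ext fun t => adjoint_injective_of_denseRange hdense <| by
    rw [heq, hv, map_zero, map_zero]
    exact (map_zero _).symm
  rw [hv, hy]
  rfl

variable (hι : Function.Injective ι) (hdense : DenseRange ι) (ha : GardingInequality ι a α ρ)
  {d : L2 T V × H} {s s' : L2 T V × C(Icc (0 : ℝ) T, H)}
include hι hdense ha

variable (d) in
theorem exists_mem_solutionGraph :
    ∃ s, (d, s) ∈ solutionGraph hT ι a ∧ ‖s‖ ≤ stabilityConst α ρ T * ‖d‖ := by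
  have hd : DenseRange (regularData hT ι a).toLinearMap := denseRange_regularData hι hdense ha
  have hle : ∀ w, ‖(regularSolution hT ι).toLinearMap w‖ ≤
    stabilityConst α ρ T * ‖(regularData hT ι a).toLinearMap w‖ := norm_regularSolution_le ha
  set solve := (regularSolution hT ι).toLinearMap.extendOfNorm (regularData hT ι a).toLinearMap
  refine ⟨solve d, ?_, LinearMap.norm_extendOfNorm_apply_le hd _ hle d⟩
  refine hd.induction_on (p := fun d => (d, solve d) ∈ solutionGraph hT ι a) d
    ((isClosed_solutionGraph hT ι a).preimage (by fun_prop)) fun w => ?_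
  rw [LinearMap.extendOfNorm_eq hd ⟨_, hle⟩ w]
  exact regular_mem_solutionGraph w

theorem solutionGraph_unique (hs : (d, s) ∈ solutionGraph hT ι a)
    (hs' : (d, s') ∈ solutionGraph hT ι a) : s = s' :=
  sub_eq_zero.1 (solutionGraph_snd_eq_zero hι hdense ha (by
    simpa only [Prod.mk_sub_mk, sub_self] using sub_mem hs hs'))

theorem norm_le_of_mem_solutionGraph (hs : (d, s) ∈ solutionGraph hT ι a) :
    ‖s‖ ≤ stabilityConst α ρ T * ‖d‖ := by
  obtain ⟨s', hs', hle⟩ := exists_mem_solutionGraph (hT := hT) hι hdense ha d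
  rwa [solutionGraph_unique hι hdense ha hs hs']

theorem norm_sub_le_of_mem_solutionGraph {a' : V →L[ℝ] V} (hs : (d, s) ∈ solutionGraph hT ι a)
    (hs' : (d, s') ∈ solutionGraph hT ι a') :
    ‖s' - s‖ ≤ stabilityConst α ρ T * (‖a' - a‖ * ‖s'‖) := by
  obtain ⟨F, y₀⟩ := d
  obtain ⟨v', y'⟩ := s'
  set G := pointwise T (a' - a) v'
  have hM := stabilityConst_nonneg (T := T) ha
  have hsplit : pointwise T a' v' + F = pointwise T a v' + (F + G) := by
    have h := ContinuousLinearMap.add_compLpL (p := 2) (μ := timeMeasure T) a (a' - a)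
    rw [add_sub_cancel] at h
    rw [pointwise, h, add_apply, add_assoc, add_comm F]
  have hperturbed : ((F + G, y₀), (v', y')) ∈ solutionGraph hT ι a := by
    obtain ⟨hv', heq⟩ := mem_solutionGraph.1 hs'
    rw [hsplit] at heq
    exact mem_solutionGraph.2 ⟨hv', heq⟩
  have hdiff : ((G, 0), (v', y') - s) ∈ solutionGraph hT ι a := by
    simpa only [Prod.mk_sub_mk, sub_self, add_sub_cancel_left] using sub_mem hperturbed hs
  calc ‖(v', y') - s‖ ≤ stabilityConst α ρ T * ‖((G, 0) : L2 T V × H)‖ :=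
        norm_le_of_mem_solutionGraph hι hdense ha hdiff
    _ ≤ stabilityConst α ρ T * (‖a' - a‖ * ‖(v', y')‖) := by
        rw [Prod.norm_mk, norm_zero, max_eq_left (norm_nonneg G)]
        gcongr
        exact ((a' - a).norm_compLp_le v').trans
          (mul_le_mul_of_nonneg_left (norm_fst_le (v', y')) (norm_nonneg _))

end SolutionGraph

section Riesz

variable (V : Type*) [NormedAddCommGroup V] [InnerProductSpace ℝ V] [CompleteSpace V]

/-- The Riesz isomorphism `v ↦ ⟨v, ·⟩` of a real Hilbert space with its dual.
`InnerProductSpace.toDual ℝ V` is only available as a conjugate-linear map. -/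
noncomputable def riesz : V ≃ₗᵢ[ℝ] StrongDual ℝ V where
  toLinearEquiv :=
    { (InnerProductSpace.toDual ℝ V).toLinearEquiv.toAddEquiv with
      map_smul' := (InnerProductSpace.toDual ℝ V).map_smulₛₗ }
  norm_map' := (InnerProductSpace.toDual ℝ V).norm_map

variable {V}

theorem riesz_apply (v w : V) : riesz V v w = ⟪v, w⟫ :=
  InnerProductSpace.toDual_apply_apply

theorem inner_riesz_symm (φ : StrongDual ℝ V) (v : V) : ⟪(riesz V).symm φ, v⟫ = φ v := by
  rw [← riesz_apply, LinearIsometryEquiv.apply_symm_apply]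

end Riesz

namespace Problem

variable {U V H : Type*}
  [NormedAddCommGroup U] [InnerProductSpace ℝ U]
  [NormedAddCommGroup V] [InnerProductSpace ℝ V] [CompleteSpace V]
  [NormedAddCommGroup H] [InnerProductSpace ℝ H]
  (Q : Problem U V H)

/-- The operator on `V` which represents `A(σ)` through the Riesz isomorphism. -/
noncomputable def rieszA (σ : Param) : V →L[ℝ] V := (riesz V).symm ∘L Q.A σ

theorem continuous_rieszA : Continuous Q.rieszA :=
  continuous_const.clm_comp Q.A_continuous

theorem exists_gardingInequality : ∃ α ρ : ℝ, ∀ σ, GardingInequality Q.ι (Q.rieszA σ) α ρ := by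
  obtain ⟨ρ, α, hα, hA⟩ := Q.A_coercive
  refine ⟨α, max ρ 0, fun σ => ⟨hα, le_max_right _ _, fun v => ?_⟩⟩
  have hρ : ρ * ‖Q.ι v‖ ^ 2 ≤ max ρ 0 * ‖Q.ι v‖ ^ 2 := by gcongr; exact le_max_left _ _
  have hv : ⟪Q.rieszA σ v, v⟫ = Q.A σ v v := inner_riesz_symm _ _
  linarith [hA σ v]

variable [CompleteSpace H]

theorem toDual_eq_riesz (h : H) : Q.toDual h = riesz V ((Q.ι†) h) := by
  ext v
  rw [riesz_apply, ContinuousLinearMap.adjoint_inner_left]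
  rfl

/-- The data `(ι†B u + f, y₀)` of the state equation, with `V'` identified with `V`. -/
noncomputable def data (u : L2 Q.T U) : L2 Q.T V × H :=
  (pointwise Q.T (Q.ι† ∘L Q.B) u + pointwise Q.T (riesz V).symm Q.f, Q.y₀)

theorem coeFn_rhs (σ : Param) (u : L2 Q.T U) (v : L2 Q.T V) :
    pointwise Q.T (riesz V) (pointwise Q.T (Q.rieszA σ) v + (Q.data u).1) =ᵐ[timeMeasure Q.T]
      fun t => Q.A σ (v t) + Q.toDual (Q.B (u t)) + Q.f t := by
  filter_upwards [((riesz V : V →L[ℝ] StrongDual ℝ V)).coeFn_compLpL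
      (pointwise Q.T (Q.rieszA σ) v + (Q.data u).1),
    Lp.coeFn_add (pointwise Q.T (Q.rieszA σ) v) (Q.data u).1, (Q.rieszA σ).coeFn_compLpL v,
    Lp.coeFn_add (pointwise Q.T (Q.ι† ∘L Q.B) u) (pointwise Q.T (riesz V).symm Q.f),
    (Q.ι† ∘L Q.B).coeFn_compLpL u,
    ((riesz V).symm : StrongDual ℝ V →L[ℝ] V).coeFn_compLpL Q.f] with t h1 h2 h3 h4 h5 h6
  rw [h1, h2, Pi.add_apply, h3, show (Q.data u).1 t = _ from h4, Pi.add_apply, h5, h6,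
    toDual_eq_riesz, add_assoc]
  simp only [map_add]
  exact congrArg₂ (· + ·) ((riesz V).apply_symm_apply _)
    (congrArg₂ (· + ·) rfl ((riesz V).apply_symm_apply _))

variable {Q}

omit [CompleteSpace V] [CompleteSpace H] in
theorem pointwise_ι_eq_toL2_iff {v : L2 Q.T V} {y : C(Icc (0 : ℝ) Q.T, H)} :
    pointwise Q.T Q.ι v = toL2 Q.T_pos.le H y ↔
      ∀ᵐ t ∂timeMeasure Q.T, Q.ι (v t) = Q.eval y t :=
  Lp.ext_iff.trans
    ⟨fun h => (Q.ι.coeFn_compLpL v).symm.trans (h.trans (coeFn_toL2 Q.T_pos.le y)),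
      fun h : _ =ᵐ[_] _ =>
        (Q.ι.coeFn_compLpL v).trans (h.trans (coeFn_toL2 Q.T_pos.le y).symm)⟩

theorem hasWeakTimeDeriv_toDual_iff {v : L2 Q.T V} {y : C(Icc (0 : ℝ) Q.T, H)} {z : L2 Q.T V}
    (hvy : ∀ᵐ t ∂timeMeasure Q.T, Q.ι (v t) = Q.eval y t) :
    HasWeakTimeDeriv Q.T (fun t => Q.toDual (Q.ι (v t))) (pointwise Q.T (riesz V) z) ↔
      ∀ t, (Q.ι†) (y t) = (Q.ι†) (Q.eval y 0) + primitive Q.T V z t := by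
  set E : H →L[ℝ] StrongDual ℝ V := (riesz V : V →L[ℝ] StrongDual ℝ V) ∘L Q.ι†
  have hE : (fun t => Q.toDual (Q.ι (v t))) =ᵐ[timeMeasure Q.T]
      IccExtend Q.T_pos.le ((E : C(H, StrongDual ℝ V)).comp y) := by
    filter_upwards [hvy] with t ht
    rw [ht, toDual_eq_riesz]
    rfl
  have hy0 : Q.eval y 0 = y ⟨0, left_mem_Icc.2 Q.T_pos.le⟩ := IccExtend_of_mem _ _ _
  have hiff (t : Icc (0 : ℝ) Q.T) : E (y t) = E (Q.eval y 0) +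
      primitive Q.T (StrongDual ℝ V) (pointwise Q.T (riesz V) z) t ↔
      (Q.ι†) (y t) = (Q.ι†) (Q.eval y 0) + primitive Q.T V z t := by
    rw [primitive_pointwise, ← (riesz V).injective.eq_iff, map_add]
    rfl
  constructor
  · intro h t
    rw [← hiff, hy0]
    exact eq_add_primitive_of_hasWeakTimeDeriv Q.T_pos (h.congr hE .rfl) t
  · intro h
    exact (hasWeakTimeDeriv_of_eq_add_primitive Q.T_pos.le fun t => (hiff t).2 (h t)).congr
      hE.symm .rfl

theorem isState_iff {σ : Param} {u : L2 Q.T U} {y : C(Icc (0 : ℝ) Q.T, H)} :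
    Q.IsState σ u y ↔ ∃ v, (Q.data u, (v, y)) ∈ solutionGraph Q.T_pos.le Q.ι (Q.rieszA σ) := by
  refine exists_congr fun v => ?_
  rw [data, mem_solutionGraph, pointwise_ι_eq_toL2_iff]
  constructor
  · rintro ⟨dv, hweak, hvy, hdv, hy0⟩
    refine ⟨hvy, ?_⟩
    rw [← hy0]
    have hz : dv =ᵐ[timeMeasure Q.T] _ := hdv
    exact (hasWeakTimeDeriv_toDual_iff hvy).1 (hweak.congr .rfl (hz.trans (Q.coeFn_rhs σ u v).symm))
  · rintro ⟨hvy, heq⟩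
    have hy0 : Q.eval y 0 = Q.y₀ := adjoint_injective_of_denseRange Q.ι_denseRange <| by
      have h := heq ⟨0, left_mem_Icc.2 Q.T_pos.le⟩
      rw [primitive_apply, intervalIntegral.integral_same, add_zero] at h
      rw [← h, eval, IccExtend_of_mem _ _ (left_mem_Icc.2 Q.T_pos.le)]
    rw [← hy0] at heq
    exact ⟨_, (hasWeakTimeDeriv_toDual_iff hvy).2 heq, hvy, Q.coeFn_rhs σ u v, hy0⟩

variable (Q)

theorem existsUnique_isState (σ : Param) (u : L2 Q.T U) : ∃! y, Q.IsState σ u y := by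
  obtain ⟨α, ρ, ha⟩ := Q.exists_gardingInequality
  obtain ⟨⟨v, y⟩, hs, -⟩ :=
    exists_mem_solutionGraph (hT := Q.T_pos.le) Q.ι_injective Q.ι_denseRange (ha σ) (Q.data u)
  refine ⟨y, isState_iff.2 ⟨v, hs⟩, fun y' hy' => ?_⟩
  obtain ⟨v', hs'⟩ := isState_iff.1 hy'
  exact congrArg Prod.snd (solutionGraph_unique Q.ι_injective Q.ι_denseRange (ha σ) hs' hs)

theorem isState_state (u : L2 Q.T U) (σ : Param) : Q.IsState σ u (Q.state u σ) :=
  Classical.epsilon_spec (Q.existsUnique_isState σ u).exists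

theorem continuous_state (u : L2 Q.T U) : Continuous (Q.state u) := by
  obtain ⟨α, ρ, ha⟩ := Q.exists_gardingInequality
  choose v hv using fun σ => isState_iff.1 (Q.isState_state u σ)
  set M := stabilityConst α ρ Q.T
  refine continuous_iff_continuousAt.2 fun σ₀ => tendsto_iff_norm_sub_tendsto_zero.2 ?_
  have hle (σ : Param) : ‖Q.state u σ - Q.state u σ₀‖ ≤
      M * (‖Q.rieszA σ - Q.rieszA σ₀‖ * (M * ‖Q.data u‖)) := by
    have hM : 0 ≤ M := stabilityConst_nonneg (ha σ)
    calc _ ≤ ‖(v σ, Q.state u σ) - (v σ₀, Q.state u σ₀)‖ := norm_snd_le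
          ((v σ, Q.state u σ) - (v σ₀, Q.state u σ₀))
      _ ≤ M * (‖Q.rieszA σ - Q.rieszA σ₀‖ * ‖(v σ, Q.state u σ)‖) :=
        norm_sub_le_of_mem_solutionGraph Q.ι_injective Q.ι_denseRange (ha σ₀) (hv σ₀) (hv σ)
      _ ≤ _ := by
        gcongr
        exact norm_le_of_mem_solutionGraph Q.ι_injective Q.ι_denseRange (ha σ) (hv σ)
  refine squeeze_zero (fun _ => norm_nonneg _) hle ?_
  have h : Continuous fun σ => M * (‖Q.rieszA σ - Q.rieszA σ₀‖ * (M * ‖Q.data u‖)) :=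
    continuous_const.mul (((Q.continuous_rieszA.sub continuous_const).norm).mul continuous_const)
  have h0 := h.tendsto σ₀
  rwa [sub_self, norm_zero, zero_mul, mul_zero] at h0

theorem data_convexComb (u w : L2 Q.T U) {r s : ℝ} (hrs : r + s = 1) :
    Q.data (r • u + s • w) = r • Q.data u + s • Q.data w := by
  obtain rfl := eq_sub_of_add_eq' hrs
  simp only [data, map_add, map_smul, Prod.smul_mk, Prod.mk_add_mk, Prod.mk.injEq]
  constructor <;> module

theorem data_sub (u w : L2 Q.T U) :
    Q.data u - Q.data w = (pointwise Q.T (Q.ι† ∘L Q.B) (u - w), 0) := by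
  rw [data, data, Prod.mk_sub_mk, sub_self, add_sub_add_right_eq_sub, ← map_sub]

theorem state_convexComb (u w : L2 Q.T U) {r s : ℝ} (hrs : r + s = 1) (σ : Param) :
    Q.state (r • u + s • w) σ = r • Q.state u σ + s • Q.state w σ := by
  obtain ⟨v, hv⟩ := isState_iff.1 (Q.isState_state u σ)
  obtain ⟨v', hv'⟩ := isState_iff.1 (Q.isState_state w σ)
  refine (Q.existsUnique_isState σ _).unique (Q.isState_state _ σ) (isState_iff.2
    ⟨r • v + s • v', ?_⟩)
  rw [Q.data_convexComb u w hrs]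
  simpa only [Prod.smul_mk, Prod.mk_add_mk] using
    Submodule.add_mem _ (Submodule.smul_mem _ r hv) (Submodule.smul_mem _ s hv')

theorem exists_lipschitzWith_state : ∃ K, ∀ σ, LipschitzWith K fun u => Q.state u σ := by
  obtain ⟨α, ρ, ha⟩ := Q.exists_gardingInequality
  refine ⟨_, fun σ => LipschitzWith.of_dist_le'
    (K := stabilityConst α ρ Q.T * ‖pointwise Q.T (Q.ι† ∘L Q.B)‖) fun u w => ?_⟩
  have hM : 0 ≤ stabilityConst α ρ Q.T := stabilityConst_nonneg (ha σ)
  obtain ⟨v, hv⟩ := isState_iff.1 (Q.isState_state u σ)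
  obtain ⟨v', hv'⟩ := isState_iff.1 (Q.isState_state w σ)
  have hmem : (Q.data u - Q.data w, (v - v', Q.state u σ - Q.state w σ)) ∈
      solutionGraph Q.T_pos.le Q.ι (Q.rieszA σ) := by
    simpa only [Prod.mk_sub_mk] using Submodule.sub_mem _ hv hv'
  rw [dist_eq_norm, dist_eq_norm, mul_assoc]
  calc ‖Q.state u σ - Q.state w σ‖ ≤ ‖(v - v', Q.state u σ - Q.state w σ)‖ :=
        norm_snd_le (v - v', Q.state u σ - Q.state w σ)
    _ ≤ stabilityConst α ρ Q.T * ‖Q.data u - Q.data w‖ :=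
      norm_le_of_mem_solutionGraph Q.ι_injective Q.ι_denseRange (ha σ) hmem
    _ ≤ stabilityConst α ρ Q.T * (‖pointwise Q.T (Q.ι† ∘L Q.B)‖ * ‖u - w‖) := by
      rw [data_sub, Prod.norm_mk, norm_zero, max_eq_left (norm_nonneg _)]
      gcongr
      exact ContinuousLinearMap.le_opNorm _ _

theorem continuous_uncurry_state :
    Continuous fun p : L2 Q.T U × Param => Q.state p.1 p.2 := by
  obtain ⟨K, hK⟩ := Q.exists_lipschitzWith_state
  exact continuous_prod_of_continuous_lipschitzWith _ K Q.continuous_state hK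

end Problem

section StrongConvexity

variable {E : Type*} [NormedAddCommGroup E] [NormedSpace ℝ E] {s : Set E} {f : E → ℝ} {m : ℝ}

theorem mul_norm_sub_sq_le_of_strongConvexOn (hf : StrongConvexOn s m f) (hb : BddBelow (f '' s))
    {u w : E} (hu : u ∈ s) (hw : w ∈ s) :
    m / 4 * ‖u - w‖ ^ 2 ≤ (f u - sInf (f '' s)) + (f w - sInf (f '' s)) := by
  have hmid := hf.2 hu hw one_half_pos.le one_half_pos.le (add_halves 1)
  have hinf : sInf (f '' s) ≤ f ((1 / 2 : ℝ) • u + (1 / 2 : ℝ) • w) := csInf_le hb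
    (mem_image_of_mem f (hf.1 hu hw one_half_pos.le one_half_pos.le (add_halves 1)))
  simp only [smul_eq_mul] at hmid
  linarith

theorem cauchySeq_of_strongConvexOn (hm : 0 < m) (hf : StrongConvexOn s m f)
    (hb : BddBelow (f '' s)) {x : ℕ → E} (hxs : ∀ n, x n ∈ s)
    (hx : Filter.Tendsto (f ∘ x) .atTop (𝓝 (sInf (f '' s)))) : CauchySeq x := by
  set ε : ℕ → ℝ := fun n => f (x n) - sInf (f '' s)
  have hε : Filter.Tendsto ε .atTop (𝓝 0) := by
    have h := hx.sub_const (sInf (f '' s))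
    rwa [sub_self] at h
  have hbound : Filter.Tendsto (fun n : ℕ × ℕ => √(4 / m * (ε n.1 + ε n.2))) .atTop (𝓝 0) := by
    rw [← Filter.prod_atTop_atTop_eq]
    have h := (((hε.comp Filter.tendsto_fst).add (hε.comp Filter.tendsto_snd)).const_mul
      (4 / m)).sqrt
    rwa [add_zero, mul_zero, Real.sqrt_zero] at h
  refine cauchySeq_iff_tendsto_dist_atTop_0.2
    (squeeze_zero (fun _ => dist_nonneg) (fun n => Real.le_sqrt_of_sq_le ?_) hbound)
  have h := mul_norm_sub_sq_le_of_strongConvexOn hf hb (hxs n.1) (hxs n.2)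
  rw [dist_eq_norm]
  calc ‖x n.1 - x n.2‖ ^ 2 = 4 / m * (m / 4 * ‖x n.1 - x n.2‖ ^ 2) := by field_simp
    _ ≤ 4 / m * (ε n.1 + ε n.2) := by gcongr

theorem existsUnique_isMinOn_of_strongConvexOn [CompleteSpace E] (hm : 0 < m)
    (hf : StrongConvexOn s m f) (hc : ContinuousOn f s) (hb : BddBelow (f '' s))
    (hs : IsClosed s) (hne : s.Nonempty) : ∃! u, u ∈ s ∧ IsMinOn f s u := by
  obtain ⟨r, -, hr, hrs⟩ := exists_seq_tendsto_sInf (hne.image f) hb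
  choose x hxs hxr using hrs
  have hlim : Filter.Tendsto (f ∘ x) .atTop (𝓝 (sInf (f '' s))) := by
    simpa only [Function.comp_def, hxr] using hr
  obtain ⟨u, hu⟩ := cauchySeq_tendsto_of_complete (cauchySeq_of_strongConvexOn hm hf hb hxs hlim)
  have hus : u ∈ s := hs.mem_of_tendsto hu (.of_forall hxs)
  have hfu : f u = sInf (f '' s) := tendsto_nhds_unique
    ((hc u hus).tendsto.comp (tendsto_nhdsWithin_iff.2 ⟨hu, .of_forall hxs⟩)) hlim
  have hmin : IsMinOn f s u := fun w hw => hfu.trans_le (csInf_le hb (mem_image_of_mem f hw))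
  exact ⟨u, ⟨hus, hmin⟩, fun w hw =>
    (hf.strictConvexOn hm).eq_of_isMinOn hw.2 hmin hw.1 hus⟩

end StrongConvexity

section CumulantGeneratingFunction

open ProbabilityTheory

variable {Ω : Type*} [MeasurableSpace Ω] {μ : Measure Ω} {X Y : Ω → ℝ} {t a b : ℝ}

theorem exp_convexComb_le (c d : ℝ) (x y : ℝ) (ha : 0 ≤ a) (hb : 0 ≤ b) (hab : a + b = 1) :
    Real.exp (a * x + b * y) ≤ Real.exp (a * c + b * d) *
      (a * (Real.exp x / Real.exp c) + b * (Real.exp y / Real.exp d)) := by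
  have h := convexOn_exp.2 (mem_univ (x - c)) (mem_univ (y - d)) ha hb hab
  simp only [smul_eq_mul, Real.exp_sub] at h
  calc Real.exp (a * x + b * y)
      = Real.exp (a * c + b * d) * Real.exp (a * (x - c) + b * (y - d)) := by
        rw [← Real.exp_add]
        ring_nf
    _ ≤ _ := by gcongr

theorem integrable_exp_mul_convexComb (hX : Integrable (fun x => Real.exp (t * X x)) μ)
    (hY : Integrable (fun x => Real.exp (t * Y x)) μ) (ha : 0 ≤ a) (hb : 0 ≤ b)
    (hab : a + b = 1) : Integrable (fun x => Real.exp (t * (a * X x + b * Y x))) μ := by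
  have hmeas : AEStronglyMeasurable (fun x => Real.exp (t * (a * X x + b * Y x))) μ := by
    have h := ((hX.aemeasurable.log.const_mul a).add (hY.aemeasurable.log.const_mul b)).exp
    simp only [Real.log_exp] at h
    exact (h.congr (.of_forall fun x => by simp only [Pi.add_apply]; ring_nf)).aestronglyMeasurable
  refine ((hX.const_mul a).add (hY.const_mul b)).mono' hmeas (.of_forall fun x => ?_)
  have h := convexOn_exp.2 (mem_univ (t * X x)) (mem_univ (t * Y x)) ha hb hab
  rw [Real.norm_of_nonneg (Real.exp_nonneg _)]
  simpa only [smul_eq_mul, Pi.add_apply, mul_add, mul_left_comm t] using h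

-- Hölder's inequality, by Young's inequality for the normalized weights `exp (t X) / mgf X μ t`
theorem cgf_convexComb_le [NeZero μ] (hX : Integrable (fun x => Real.exp (t * X x)) μ)
    (hY : Integrable (fun x => Real.exp (t * Y x)) μ) (ha : 0 ≤ a) (hb : 0 ≤ b)
    (hab : a + b = 1) :
    cgf (fun x => a * X x + b * Y x) μ t ≤ a * cgf X μ t + b * cgf Y μ t := by
  have hinteg := integrable_exp_mul_convexComb hX hY ha hb hab
  rw [← Real.exp_le_exp, exp_cgf hinteg]
  have hXY := ((hX.div_const (mgf X μ t)).const_mul a).add ((hY.div_const (mgf Y μ t)).const_mul b)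
  calc mgf (fun x => a * X x + b * Y x) μ t
      ≤ ∫ x, Real.exp (a * cgf X μ t + b * cgf Y μ t) *
          (a * (Real.exp (t * X x) / mgf X μ t) + b * (Real.exp (t * Y x) / mgf Y μ t)) ∂μ := by
        refine integral_mono hinteg (hXY.const_mul _) fun x => ?_
        have h := exp_convexComb_le (cgf X μ t) (cgf Y μ t) (t * X x) (t * Y x) ha hb hab
        rw [exp_cgf hX, exp_cgf hY] at h
        refine le_trans (le_of_eq ?_) h
        ring_nf
    _ = Real.exp (a * cgf X μ t + b * cgf Y μ t) * (a * (mgf X μ t / mgf X μ t) +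
          b * (mgf Y μ t / mgf Y μ t)) := by
        rw [integral_const_mul, integral_add ((hX.div_const _).const_mul a)
          ((hY.div_const _).const_mul b), integral_const_mul, integral_const_mul, integral_div,
          integral_div]
        rfl
    _ = Real.exp (a * cgf X μ t + b * cgf Y μ t) := by
        rw [div_self (mgf_pos_iff.2 hX).ne', div_self (mgf_pos_iff.2 hY).ne', mul_one, mul_one,
          hab, mul_one]

end CumulantGeneratingFunction

section EntropicRisk

open ProbabilityTheory

instance : IsProbabilityMeasure paramMeasure :=
  inferInstanceAs (IsProbabilityMeasure (Measure.infinitePi _))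

variable {θ : ℝ} {X Y : Param → ℝ}

theorem entropicRisk_eq_cgf (θ : ℝ) (X : Param → ℝ) :
    entropicRisk θ X = 1 / θ * cgf X paramMeasure θ := rfl

theorem entropicRisk_mono (hθ : 0 < θ) (hX : Integrable (fun σ => Real.exp (θ * X σ)) paramMeasure)
    (hY : Integrable (fun σ => Real.exp (θ * Y σ)) paramMeasure) (h : ∀ σ, X σ ≤ Y σ) :
    entropicRisk θ X ≤ entropicRisk θ Y := by
  have hpos := mgf_pos hX
  rw [entropicRisk_eq_cgf, entropicRisk_eq_cgf, cgf, cgf]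
  gcongr
  exact mgf_mono_of_nonneg (.of_forall h) hθ.le hY

theorem entropicRisk_nonneg (hθ : 0 < θ)
    (hX : Integrable (fun σ => Real.exp (θ * X σ)) paramMeasure) (h : ∀ σ, 0 ≤ X σ) :
    0 ≤ entropicRisk θ X := by
  have h0 : entropicRisk θ (fun _ => 0) = 0 := by
    rw [entropicRisk_eq_cgf, cgf_const, mul_zero, mul_zero]
  exact h0.symm.trans_le (entropicRisk_mono hθ (integrable_const _) hX h)

theorem entropicRisk_convexComb_le (hθ : 0 < θ)
    (hX : Integrable (fun σ => Real.exp (θ * X σ)) paramMeasure)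
    (hY : Integrable (fun σ => Real.exp (θ * Y σ)) paramMeasure) {a b : ℝ} (ha : 0 ≤ a)
    (hb : 0 ≤ b) (hab : a + b = 1) :
    entropicRisk θ (fun σ => a * X σ + b * Y σ) ≤
      a * entropicRisk θ X + b * entropicRisk θ Y := by
  simp only [entropicRisk_eq_cgf]
  calc _ ≤ 1 / θ * (a * cgf X paramMeasure θ + b * cgf Y paramMeasure θ) := by
        gcongr
        exact cgf_convexComb_le hX hY ha hb hab
    _ = _ := by ring

theorem integrable_exp_mul (hX : Continuous X) :
    Integrable (fun σ => Real.exp (θ * X σ)) paramMeasure :=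
  Continuous.integrable_of_hasCompactSupport (by fun_prop) (.of_compactSpace _)

theorem continuous_entropicRisk {Z : Type*} [TopologicalSpace Z] {f : Z → Param → ℝ}
    (hf : Continuous f.uncurry) : Continuous fun z => entropicRisk θ (f z) := by
  have hexp : Continuous (fun z σ => Real.exp (θ * f z σ)).uncurry :=
    Real.continuous_exp.comp (hf.const_mul θ)
  have hmgf : Continuous fun z => mgf (f z) paramMeasure θ := continuousOn_univ.1 <|
    continuousOn_integral_of_compact_support isCompact_univ hexp.continuousOn
      fun _ σ _ hσ => absurd (mem_univ σ) hσ
  exact continuous_const.mul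
    (hmgf.log fun z => (mgf_pos (integrable_exp_mul (hf.uncurry_left z))).ne')

end EntropicRisk

namespace Problem

variable {U V H : Type*}
  [NormedAddCommGroup U] [InnerProductSpace ℝ U]
  [NormedAddCommGroup V] [InnerProductSpace ℝ V]
  [NormedAddCommGroup H] [InnerProductSpace ℝ H]
  (Q : Problem U V H)

/-- The squared distance at time `t` between the observed state and the observed target `z`,
as a random variable. -/
noncomputable def misfit (D : H →L[ℝ] H) (u : L2 Q.T U) (t : ℝ) (z : H) (σ : Param) : ℝ :=
  ‖D (Q.eval (Q.state u σ) t - z)‖ ^ 2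

/-- The risk of the deviation from the target `g` at time `t`: the part of `runningCost` which
depends on the control through the state only. -/
noncomputable def runningRisk (u : L2 Q.T U) (t : ℝ) : ℝ :=
  entropicRisk Q.θ (Q.misfit Q.C u t (Q.eval Q.g t))

/-- The risk of the deviation from the target `gT` at the final time. -/
noncomputable def terminalRisk (u : L2 Q.T U) : ℝ :=
  entropicRisk Q.θ (Q.misfit Q.P u Q.T Q.gT)

theorem integrable_norm_sq (u : L2 Q.T U) :
    Integrable (fun t => ‖u t‖ ^ 2) (timeMeasure Q.T) := by
  simpa only [real_inner_self_eq_norm_sq] using L2.integrable_inner (𝕜 := ℝ) u u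

variable [CompleteSpace V] [CompleteSpace H]

variable {Q} in
theorem continuous_misfit_comp (D : H →L[ℝ] H) {Z : Type*} [TopologicalSpace Z]
    {u : Z → L2 Q.T U} {t : Z → ℝ} {z : Z → H} {σ : Z → Param} (hu : Continuous u)
    (ht : Continuous t) (hz : Continuous z) (hσ : Continuous σ) :
    Continuous fun x => Q.misfit D (u x) (t x) (z x) (σ x) :=
  (D.continuous.comp (((Q.continuous_uncurry_state.comp (hu.prodMk hσ)).eval
    (continuous_projIcc.comp ht)).sub hz)).norm.pow 2

theorem continuous_misfit (D : H →L[ℝ] H) (u : L2 Q.T U) (t : ℝ) (z : H) :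
    Continuous (Q.misfit D u t z) :=
  continuous_misfit_comp D continuous_const continuous_const continuous_const continuous_id

theorem convexOn_misfit (D : H →L[ℝ] H) (t : ℝ) (z : H) (σ : Param) :
    ConvexOn ℝ univ fun u => Q.misfit D u t z σ := by
  refine ⟨convex_univ, fun u _ w _ a b ha hb hab => ?_⟩
  have haff : D (Q.eval (Q.state (a • u + b • w) σ) t - z) =
      a • D (Q.eval (Q.state u σ) t - z) + b • D (Q.eval (Q.state w σ) t - z) := by
    rw [Q.state_convexComb u w hab, ← map_smul, ← map_smul, ← map_add]
    congr 1
    calc _ = a • Q.eval (Q.state u σ) t + b • Q.eval (Q.state w σ) t - (a + b) • z := by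
          rw [hab, one_smul]; rfl
      _ = _ := by module
  simp only [misfit, haff]
  exact (convexOn_univ_norm.pow (fun _ _ => norm_nonneg _) 2).2 (mem_univ _) (mem_univ _) ha hb hab

variable {Q} in
theorem continuous_entropicRisk_misfit_comp (D : H →L[ℝ] H) {Z : Type*} [TopologicalSpace Z]
    {u : Z → L2 Q.T U} {t : Z → ℝ} {z : Z → H} (hu : Continuous u) (ht : Continuous t)
    (hz : Continuous z) : Continuous fun x => entropicRisk Q.θ (Q.misfit D (u x) (t x) (z x)) :=
  continuous_entropicRisk (continuous_misfit_comp D (hu.comp continuous_fst)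
    (ht.comp continuous_fst) (hz.comp continuous_fst) continuous_snd)

theorem entropicRisk_misfit_nonneg (D : H →L[ℝ] H) (u : L2 Q.T U) (t : ℝ) (z : H) :
    0 ≤ entropicRisk Q.θ (Q.misfit D u t z) :=
  entropicRisk_nonneg Q.θ_pos (integrable_exp_mul (Q.continuous_misfit D u t z))
    fun _ => sq_nonneg _

theorem convexOn_entropicRisk_misfit (D : H →L[ℝ] H) (t : ℝ) (z : H) :
    ConvexOn ℝ univ fun u => entropicRisk Q.θ (Q.misfit D u t z) := by
  refine ⟨convex_univ, fun u _ w _ a b ha hb hab => ?_⟩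
  have hcont (u : L2 Q.T U) := Q.continuous_misfit D u t z
  have hcomb : Continuous fun σ => a * Q.misfit D u t z σ + b * Q.misfit D w t z σ :=
    ((hcont u).const_mul a).add ((hcont w).const_mul b)
  exact (entropicRisk_mono Q.θ_pos (integrable_exp_mul (hcont _)) (integrable_exp_mul hcomb)
    fun σ => (Q.convexOn_misfit D t z σ).2 (mem_univ u) (mem_univ w) ha hb hab).trans
    (entropicRisk_convexComb_le Q.θ_pos (integrable_exp_mul (hcont u))
      (integrable_exp_mul (hcont w)) ha hb hab)

theorem continuous_uncurry_runningRisk :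
    Continuous fun p : L2 Q.T U × ℝ => Q.runningRisk p.1 p.2 :=
  continuous_entropicRisk_misfit_comp Q.C continuous_fst continuous_snd
    (Q.g.continuous.comp (continuous_projIcc.comp continuous_snd))

theorem continuous_terminalRisk : Continuous Q.terminalRisk :=
  continuous_entropicRisk_misfit_comp Q.P continuous_id continuous_const continuous_const

theorem integrable_runningRisk (u : L2 Q.T U) :
    Integrable (Q.runningRisk u) (timeMeasure Q.T) :=
  ((Q.continuous_uncurry_runningRisk.comp (Continuous.prodMk_right u)).integrableOn_Icc).mono_set
    Ioo_subset_Icc_self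

theorem continuous_integral_runningRisk :
    Continuous fun u : L2 Q.T U => ∫ t in Ioo 0 Q.T, Q.runningRisk u t := by
  simp only [setIntegral_Ioo_eq_intervalIntegral Q.T_pos.le]
  exact intervalIntegral.continuous_parametric_intervalIntegral_of_continuous'
    Q.continuous_uncurry_runningRisk 0 Q.T

theorem convexOn_integral_runningRisk :
    ConvexOn ℝ univ fun u : L2 Q.T U => ∫ t in Ioo 0 Q.T, Q.runningRisk u t := by
  refine ⟨convex_univ, fun u _ w _ a b ha hb hab => ?_⟩
  have hu := (Q.integrable_runningRisk u).const_mul a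
  have hw := (Q.integrable_runningRisk w).const_mul b
  simp only [smul_eq_mul]
  rw [← integral_const_mul, ← integral_const_mul, ← integral_add hu hw]
  exact integral_mono (Q.integrable_runningRisk _) (hu.add hw) fun t =>
    (Q.convexOn_entropicRisk_misfit Q.C t _).2 (mem_univ u) (mem_univ w) ha hb hab

theorem integrable_runningCost (u : L2 Q.T U) :
    Integrable (Q.runningCost u (Q.state u)) (timeMeasure Q.T) :=
  (Q.integrable_runningRisk u).add (Q.integrable_norm_sq u)

theorem reducedCost_eq (u : L2 Q.T U) : Q.reducedCost u =
    1 / 2 * ((∫ t in Ioo 0 Q.T, Q.runningRisk u t) + Q.terminalRisk u) + 1 / 2 * ‖u‖ ^ 2 := by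
  have hcost : ∫ t in Ioo 0 Q.T, Q.runningCost u (Q.state u) t =
      (∫ t in Ioo 0 Q.T, Q.runningRisk u t) + ‖u‖ ^ 2 := by
    rw [norm_sq_eq_integral, ← integral_add (Q.integrable_runningRisk u) (Q.integrable_norm_sq u)]
    rfl
  rw [reducedCost, cost, hcost, terminalRisk]
  unfold misfit
  ring

theorem continuous_reducedCost : Continuous Q.reducedCost := by
  rw [funext Q.reducedCost_eq]
  exact ((Q.continuous_integral_runningRisk.add Q.continuous_terminalRisk).const_mul _).add
    (by fun_prop)

theorem le_reducedCost (u : L2 Q.T U) : 1 / 2 * ‖u‖ ^ 2 ≤ Q.reducedCost u := by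
  have hrunning : 0 ≤ ∫ t in Ioo 0 Q.T, Q.runningRisk u t :=
    integral_nonneg fun t => Q.entropicRisk_misfit_nonneg Q.C u t _
  have hterminal : 0 ≤ Q.terminalRisk u := Q.entropicRisk_misfit_nonneg Q.P u Q.T Q.gT
  rw [reducedCost_eq]
  linarith

theorem strongConvexOn_reducedCost : StrongConvexOn univ 1 Q.reducedCost := by
  rw [strongConvexOn_iff_convex]
  simp only [Q.reducedCost_eq, add_sub_cancel_right]
  exact (Q.convexOn_integral_runningRisk.add
    (Q.convexOn_entropicRisk_misfit Q.P Q.T Q.gT)).smul one_half_pos.le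

theorem existsUnique_minimizer [CompleteSpace U] :
    ∃! u : L2 Q.T U, ∀ w : L2 Q.T U, Q.reducedCost u ≤ Q.reducedCost w := by
  have hbdd : BddBelow (Q.reducedCost '' univ) :=
    ⟨0, forall_mem_image.2 fun u _ => le_trans (by positivity) (Q.le_reducedCost u)⟩
  simpa only [mem_univ, true_and, isMinOn_univ_iff] using
    existsUnique_isMinOn_of_strongConvexOn one_pos Q.strongConvexOn_reducedCost
      Q.continuous_reducedCost.continuousOn hbdd isClosed_univ univ_nonempty

theorem feasible_iff (p : L2 Q.T U × (Param → C(Icc (0 : ℝ) Q.T, H))) :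
    Q.Feasible p ↔ p.2 = Q.state p.1 :=
  ⟨fun h => funext fun σ => (Q.existsUnique_isState σ p.1).unique (h σ) (Q.isState_state p.1 σ),
    fun h σ => h ▸ Q.isState_state p.1 σ⟩

theorem existsUnique_optimal [CompleteSpace U] :
    ∃! p, Q.Feasible p ∧ ∀ q, Q.Feasible q → Q.cost p.1 p.2 ≤ Q.cost q.1 q.2 := by
  obtain ⟨u, hmin, huniq⟩ := Q.existsUnique_minimizer
  refine ⟨(u, Q.state u), ⟨(Q.feasible_iff _).2 rfl, fun ⟨w, y⟩ hwy => ?_⟩,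
    fun ⟨w, y⟩ ⟨hwy, hw⟩ => ?_⟩
  · obtain rfl : y = Q.state w := (Q.feasible_iff _).1 hwy
    exact hmin w
  · obtain rfl : y = Q.state w := (Q.feasible_iff _).1 hwy
    rw [huniq w fun w' => hw (w', Q.state w') ((Q.feasible_iff _).2 rfl)]

end Problem

end RiskAverse

theorem mainTheorem3_general
    {U V H : Type*}
    [NormedAddCommGroup U] [InnerProductSpace ℝ U] [CompleteSpace U]
    [NormedAddCommGroup V] [InnerProductSpace ℝ V] [CompleteSpace V]
    [NormedAddCommGroup H] [InnerProductSpace ℝ H] [CompleteSpace H]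
    (Q : RiskAverse.Problem U V H) :
    (∀ (σ : RiskAverse.Param) (u : RiskAverse.L2 Q.T U), ∃! y, Q.IsState σ u y) ∧
    (∀ u : RiskAverse.L2 Q.T U, Continuous (Q.state u)) ∧
    (∀ (u : RiskAverse.L2 Q.T U) (t : ℝ), MeasureTheory.Integrable
      (fun σ => Real.exp (Q.θ * ‖Q.C (Q.eval (Q.state u σ) t - Q.eval Q.g t)‖ ^ 2))
      RiskAverse.paramMeasure) ∧
    (∀ u : RiskAverse.L2 Q.T U, MeasureTheory.Integrable
      (fun σ => Real.exp (Q.θ * ‖Q.P (Q.eval (Q.state u σ) Q.T - Q.gT)‖ ^ 2))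
      RiskAverse.paramMeasure) ∧
    (∀ u : RiskAverse.L2 Q.T U,
      MeasureTheory.IntegrableOn (Q.runningCost u (Q.state u)) (Set.Ioo 0 Q.T)) ∧
    Continuous Q.reducedCost ∧
    (∀ u : RiskAverse.L2 Q.T U, 1 / 2 * ‖u‖ ^ 2 ≤ Q.reducedCost u) ∧
    StrongConvexOn Set.univ 1 Q.reducedCost ∧
    (∃! u : RiskAverse.L2 Q.T U, ∀ w : RiskAverse.L2 Q.T U, Q.reducedCost u ≤ Q.reducedCost w) ∧
    (∃! p, Q.Feasible p ∧ ∀ q, Q.Feasible q → Q.cost p.1 p.2 ≤ Q.cost q.1 q.2) :=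
  ⟨Q.existsUnique_isState, Q.continuous_state,
    fun u t => RiskAverse.integrable_exp_mul (Q.continuous_misfit Q.C u t (Q.eval Q.g t)),
    fun u => RiskAverse.integrable_exp_mul (Q.continuous_misfit Q.P u Q.T Q.gT),
    Q.integrable_runningCost, Q.continuous_reducedCost, Q.le_reducedCost,
    Q.strongConvexOn_reducedCost, Q.existsUnique_minimizer, Q.existsUnique_optimal⟩

theorem mainTheorem3
    {U V H : Type*}
    [NormedAddCommGroup U] [InnerProductSpace ℝ U] [CompleteSpace U]
    [TopologicalSpace.SeparableSpace U]
    [NormedAddCommGroup V] [InnerProductSpace ℝ V] [CompleteSpace V]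
    [TopologicalSpace.SeparableSpace V]
    [NormedAddCommGroup H] [InnerProductSpace ℝ H] [CompleteSpace H]
    [TopologicalSpace.SeparableSpace H]
    (Q : RiskAverse.Problem U V H) :
    -- the state equation is uniquely solvable, and the state depends continuously on `σ`
    (∀ (σ : RiskAverse.Param) (u : RiskAverse.L2 Q.T U), ∃! y, Q.IsState σ u y) ∧
    (∀ u : RiskAverse.L2 Q.T U, Continuous (Q.state u)) ∧
    -- the integrals defining `J` exist
    (∀ (u : RiskAverse.L2 Q.T U) (t : ℝ), MeasureTheory.Integrable
      (fun σ => Real.exp (Q.θ * ‖Q.C (Q.eval (Q.state u σ) t - Q.eval Q.g t)‖ ^ 2))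
      RiskAverse.paramMeasure) ∧
    (∀ u : RiskAverse.L2 Q.T U, MeasureTheory.Integrable
      (fun σ => Real.exp (Q.θ * ‖Q.P (Q.eval (Q.state u σ) Q.T - Q.gT)‖ ^ 2))
      RiskAverse.paramMeasure) ∧
    (∀ u : RiskAverse.L2 Q.T U,
      MeasureTheory.IntegrableOn (Q.runningCost u (Q.state u)) (Set.Ioo 0 Q.T)) ∧
    -- `J` is continuous, coercive and strongly convex
    Continuous Q.reducedCost ∧
    (∀ u : RiskAverse.L2 Q.T U, 1 / 2 * ‖u‖ ^ 2 ≤ Q.reducedCost u) ∧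
    StrongConvexOn Set.univ 1 Q.reducedCost ∧
    -- `J` has a unique minimizer
    (∃! u : RiskAverse.L2 Q.T U, ∀ w : RiskAverse.L2 Q.T U, Q.reducedCost u ≤ Q.reducedCost w) ∧
    -- the original problem has a unique solution
    (∃! p, Q.Feasible p ∧ ∀ q, Q.Feasible q → Q.cost p.1 p.2 ≤ Q.cost q.1 q.2) := by
  exact mainTheorem3_general Q
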